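/- Let $m\ge 1$, and let $\mathcal R$ be a finite commutative chain ring (a finite commutative ring with $1$ whose ideals are totally ordered by inclusion) with maximal ideal $\langle u\rangle$ of nilpotency index $e=2$ (that is, $u\ne 0=u^2$), with residue field of order $2^m$, and with $\kappa=2$, that is, $2=0$ in $\mathcal R$. (Equivalently, $\mathcal R\cong\mathbb F_{2^m}[x]/\langle x^2\rangle$.) Let $\mathcal T=\{x\in\mathcal R: x=0\text{ or }x^{2^m-1}=1\}$ be its Teichmüller set. A linear code of length $n$ over $\mathcal R$ is an $\mathcal R$-submodule $\mathcal C$ of $\mathcal R^n$. It is self-orthogonal if $\sum_{i=1}^n v_iw_i=0$ for all $v,w\in\mathcal C$. It is of type $\{\lambda_1,\lambda_2\}$ if, after a permutation of the coordinates, it is generated by the rows of a matrix $$\begin{bmatrix} I_{\lambda_1} & A_{1,1} & A_{1,2}\\ 0 & uI_{\lambda_2} & uA_{2,2}\end{bmatrix}$$ with column blocks of sizes $\lambda_1$, $\lambda_2$, $n-\lambda_1-\lambda_2$, where $A_{1,1}$ and $A_{2,2}$ have entries in $\mathcal T$ and $A_{1,2}$ has entries in $\mathcal R$. Let $\mathscr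 M_2(n;\lambda_1,\lambda_2)$ be the number of self-orthogonal codes of type $\{\lambda_1,\lambda_2\}$ and length $n$ over $\mathcal R$. **Theorem.** Let $n,\lambda_1,\lambda_2\ge 0$ be integers with $2\lambda_1+\lambda_2\le n$, and put $\Lambda_1=\lambda_1$, $\Lambda_2=\lambda_1+\lambda_2$. Then $$\mathscr M_2(n;\lambda_1,\lambda_2)=\widetilde{\mathcal S}(n;\lambda_1)\,(2^m)^{\lambda_1(n-\Lambda_2)-\frac{\lambda_1(\lambda_1-1)}{2}}{\lambda_2+n-\Lambda_2-\Lambda_1 \brack \lambda_2}_{2^m},$$ where $$\widetilde{\mathcal S}(n;\lambda_1)=\begin{cases}\displaystyle\prod_{i=0}^{\lambda_1-1}\frac{2^{m(n-1-2i)}-1}{2^{m(i+1)}-1} & \text{if } n \text{ is odd},\\[2ex] \displaystyle\frac{2^{m(n-\lambda_1)}-1}{2^{m\lambda_1}-1}\prod_{i=0}^{\lambda_1-2}\frac{2^{m(n-2-2i)}-1}{2^{m(i+1)}-1} & \text{if } \lambda_1\ne 0 \text{ and } n \text{ is even},\\[2ex] 1 & \text{if } \lambda_1=0 \text{ and } n\text{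 is even},\end{cases}$$ and ${a\brack b}_q=\prod_{i=0}^{b-1}\frac{q^a-q^i}{q^b-q^i}$ is the Gaussian binomial coefficient. -/

import Mathlib

/-- `R` is a finite commutative chain ring of even characteristic with residue field of order
`2 ^ m`, whose maximal ideal is generated by `u` and has nilpotency index `e`, and whose
ramification index is `κ`: the element `2` generates the ideal `⟨u ^ κ⟩`. When `κ = e` this says
that `2 = 0` in `R` (and then there is no ideal strictly below `⟨u ^ κ⟩` to be excluded). -/
structure IsEvenChainRing (R : Type*) [CommRing R] (u : R) (e κ m : ℕ) : Prop where
  finite : Finite R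
  chain : ∀ I J : Ideal R, I ≤ J ∨ J ≤ I
  isMaximal : (Ideal.span {u}).IsMaximal
  pow_eq_zero : u ^ e = 0
  pow_ne_zero : ∀ k < e, u ^ k ≠ 0
  card_residue : Nat.card (R ⧸ Ideal.span {u}) = 2 ^ m
  ramification_le : κ ≤ e
  two_mem : (2 : R) ∈ Ideal.span {u ^ κ}
  two_notMem : κ < e → (2 : R) ∉ Ideal.span {u ^ (κ + 1)}

/-- The Teichmüller set of a chain ring with residue field of order `2 ^ m`: zero together with
the cyclic group of the `(2 ^ m - 1)`-th roots of unity. -/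
def teichmullerSet (R : Type*) [CommRing R] (m : ℕ) : Set R :=
  {x | x = 0 ∨ x ^ (2 ^ m - 1) = 1}

/-- The Euclidean dual of a linear code `C` of length `n` over `R`. -/
def dualCode {R : Type*} [CommRing R] {n : ℕ} (C : Submodule R (Fin n → R)) :
    Submodule R (Fin n → R) where
  carrier := {w | ∀ v ∈ C, v ⬝ᵥ w = 0}
  add_mem' := by
    intro a b ha hb v hv
    rw [dotProduct_add, ha v hv, hb v hv, add_zero]
  zero_mem' := by
    intro v _
    exact dotProduct_zero v
  smul_mem' := by
    intro c a ha v hv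
    rw [dotProduct_smul, ha v hv, smul_zero]

/-- A linear code is self-orthogonal if it is contained in its Euclidean dual. -/
def IsSelfOrthogonal {R : Type*} [CommRing R] {n : ℕ} (C : Submodule R (Fin n → R)) : Prop :=
  C ≤ dualCode C

/-- The block matrix `[I, A₁₁, A₁₂; 0, u I, u A₂₂]`. -/
def standardMatrix {R : Type*} [CommRing R] (u : R) {l₁ l₂ l₃ : ℕ}
    (A₁₁ : Matrix (Fin l₁) (Fin l₂) R) (A₁₂ : Matrix (Fin l₁) (Fin l₃) R)
    (A₂₂ : Matrix (Fin l₂) (Fin l₃) R) :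
    Matrix (Fin l₁ ⊕ Fin l₂) ((Fin l₁ ⊕ Fin l₂) ⊕ Fin l₃) R :=
  Matrix.fromCols (Matrix.fromBlocks 1 A₁₁ 0 (u • 1)) (Matrix.fromRows A₁₂ (u • A₂₂))

/-- A linear code `C` of length `n` over a chain ring with maximal ideal `⟨u⟩` of nilpotency
index `2` is of type `{l₁, l₂}` if, up to a permutation of the coordinates, it has a generator
matrix in the standard form `[I, A₁₁, A₁₂; 0, u I, u A₂₂]` with column blocks of sizes
`l₁`, `l₂`, `n - (l₁ + l₂)`, where `A₁₁` and `A₂₂` are taken modulo `u`, that is, have entries in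
the Teichmüller set, and `A₁₂` is taken modulo `u ^ 2 = 0`. The bijection `τ` places the
columns of the standard form at the coordinates of the code; there is none if `n < l₁ + l₂`.
(Rows of this shape are automatically a minimal generating set of their span.) -/
def HasType {R : Type*} [CommRing R] (u : R) (m : ℕ) {n : ℕ} (C : Submodule R (Fin n → R))
    (l₁ l₂ : ℕ) : Prop :=
  ∃ (τ : (Fin l₁ ⊕ Fin l₂) ⊕ Fin (n - (l₁ + l₂)) ≃ Fin n)
    (A₁₁ : Matrix (Fin l₁) (Fin l₂) R) (A₁₂ : Matrix (Fin l₁) (Fin (n - (l₁ + l₂))) R)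
    (A₂₂ : Matrix (Fin l₂) (Fin (n - (l₁ + l₂))) R),
    (∀ i j, A₁₁ i j ∈ teichmullerSet R m) ∧ (∀ i j, A₂₂ i j ∈ teichmullerSet R m) ∧
      C = Submodule.span R
        (Set.range fun r => fun k : Fin n => standardMatrix u A₁₁ A₁₂ A₂₂ r (τ.symm k))

/-- The number of self-orthogonal codes of type `{l₁, l₂}` and length `n`. -/
noncomputable def numSelfOrthogonal {R : Type*} [CommRing R] (u : R) (m n l₁ l₂ : ℕ) : ℕ :=
  Nat.card {C : Submodule R (Fin n → R) // IsSelfOrthogonal C ∧ HasType u m C l₁ l₂}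

/-- The Gaussian binomial coefficient `[a choose b]_q`. -/
def gaussBinom (q : ℚ) (a b : ℕ) : ℚ :=
  ∏ i ∈ Finset.range b, (q ^ a - q ^ i) / (q ^ b - q ^ i)

/-- The number `S̃(n; l)` for the field of order `2 ^ m`. For `2 l ≤ n` none of the natural number
subtractions below truncates: in the odd case `2 i + 1 < n` for all `i < l`, and in the even case
`2 i + 2 < n` for all `i < l - 1`. -/
def numS (m n l : ℕ) : ℚ :=
  if Odd n then
    ∏ i ∈ Finset.range l, ((2 : ℚ) ^ (m * (n - 1 - 2 * i)) - 1) / ((2 : ℚ) ^ (m * (i + 1)) - 1)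
  else if l = 0 then 1
  else
    (((2 : ℚ) ^ (m * (n - l)) - 1) / ((2 : ℚ) ^ (m * l) - 1)) *
      ∏ i ∈ Finset.range (l - 1),
        ((2 : ℚ) ^ (m * (n - 2 - 2 * i)) - 1) / ((2 : ℚ) ^ (m * (i + 1)) - 1)

/-!
Write `F` for the residue field, `q = 2 ^ m` for its order and `V = F ^ n`. Since `2 = 0` in `R`,
the map `x ↦ x ^ q` is a ring endomorphism of `R` that kills `⟨u⟩`; it induces a section `F → R` of
the residue map whose image is the Teichmüller set, and `R = F ⊕ u F` is the ring of dual numbers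
(`IsEvenChainRing.isDualNumberRing`). A code `C` then has a residue code `A ≤ V` and a torsion code
`B = {b | u b ∈ C}`, with `A ≤ B`, and `C` is generated by `u B` and by lifts `aᵢ + u bᵢ` of a basis
of `A`, where the `bᵢ` are unique modulo `B` (`liftCode`). Choosing pivots of `A` and completing
them to pivots of `B` shows that `C` has type `{l₁, l₂}` exactly when `dim A = l₁` and
`dim B = l₁ + l₂` (`finrank_of_hasType`, `hasType_of_finrank`).

Self-orthogonality of `C` means `A ⊆ B ⊆ A^⊥` together with the symmetry of the matrix `aᵢ ⬝ᵥ bⱼ`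
(the sign is irrelevant and the diagonal imposes nothing, as `2 = 0`). These are
`l₁ (l₁ - 1) / 2` independent linear conditions on `(bᵢ)`, so each admissible pair `(A, B)` comes
from `q ^ (l₁ (n - l₁ - l₂) - l₁ (l₁ - 1) / 2)` codes (`card_selfOrthogonal_code`). For given `A` the
spaces `B` are counted by the Gaussian binomial coefficient of `l₂`-dimensional subspaces of a space
of dimension `n - 2 l₁` (`card_submodule_between`).

It remains to count the self-orthogonal `A` of dimension `l₁` (`card_selfOrthogonal`). In
characteristic two `x ⬝ᵥ x = (∑ xᵢ) ^ 2`, so these are the totally isotropic subspaces of the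
alternating form on the hyperplane `∑ xᵢ = 0`, whose radical is zero for odd `n` and the line of
constant vectors for even `n`. Totally isotropic subspaces avoiding the radical are counted by
building frames one vector at a time (`card_isotropic_frames`), and those containing it by passing
to a complement (`card_isotropic_ker_le`).
-/

open Module Submodule

/-! ### Counting subspaces by their frames -/

theorem card_eq_card_mul_of_card_fiber {α β : Type*} [Finite α] [Finite β] (f : α → β) (c : ℕ)
    (h : ∀ b, Nat.card {a // f a = b} = c) : Nat.card α = Nat.card β * c := by
  classical
  cases nonempty_fintype β
  rw [← Nat.card_congr (Equiv.sigmaFiberEquiv f), Nat.card_sigma]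
  simp [h]

section Frames

variable {F V : Type*} [Field F] [AddCommGroup V] [Module F V] [Finite V]

theorem card_mem_notMem {D E : Submodule F V} (h : E ≤ D) :
    Nat.card {x : V // x ∈ D ∧ x ∉ E} =
      Nat.card F ^ finrank F D - Nat.card F ^ finrank F E := by
  rw [← natCard_eq_pow_finrank (K := F) (V := D), ← natCard_eq_pow_finrank (K := F) (V := E)]
  change Nat.card ((D : Set V) \ (E : Set V) : Set V) = Nat.card (D : Set V) - Nat.card (E : Set V)
  simp only [Nat.card_coe_set_eq]
  exact Set.ncard_sdiff h

variable [Finite F]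

theorem card_frames {k : ℕ} (hk : k ≤ finrank F V) :
    Nat.card {v : Fin k → V // LinearIndependent F v} =
      ∏ i ∈ Finset.range k, (Nat.card F ^ finrank F V - Nat.card F ^ i) := by
  cases nonempty_fintype F
  rw [card_linearIndependent hk, Nat.card_eq_fintype_card,
    Fin.prod_univ_eq_prod_range
      (fun i => Fintype.card F ^ finrank F V - Fintype.card F ^ i)]

/-- The tuples spanning a given `k`-dimensional subspace `A` are the bases of `A`, so each `A` is
counted as often as there are ordered bases of a `k`-dimensional space. -/
theorem card_frames_span (k : ℕ) (P : Submodule F V → Prop) :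
    Nat.card {v : Fin k → V // LinearIndependent F v ∧ P (span F (Set.range v))} =
      Nat.card {A : Submodule F V // finrank F A = k ∧ P A} *
        ∏ i ∈ Finset.range k, (Nat.card F ^ k - Nat.card F ^ i) := by
  refine card_eq_card_mul_of_card_fiber
    (fun v => ⟨span F (Set.range v.1), by simp [finrank_span_eq_card v.2.1], v.2.2⟩) _ ?_
  rintro ⟨A, hA, hP⟩
  have h := card_frames (F := F) (V := A) (k := k) hA.ge
  rw [hA] at h
  rw [← h]
  refine Nat.card_congr
    { toFun := fun v => ⟨fun i => ⟨v.1.1 i, ?_⟩, ?_⟩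
      invFun := fun w => ⟨⟨fun i => (w.1 i : V), ?_⟩, ?_⟩
      left_inv := fun v => rfl
      right_inv := fun w => rfl }
  · have hv : span F (Set.range v.1.1) = A := congrArg Subtype.val v.2
    exact hv.le (subset_span (Set.mem_range_self i))
  · exact LinearIndependent.of_comp A.subtype v.1.2.1
  · have hw : LinearIndependent F (fun i => (w.1 i : V)) :=
      w.2.map' A.subtype A.ker_subtype
    have hs : span F (Set.range fun i => (w.1 i : V)) = A := by
      refine eq_of_le_of_finrank_eq (span_le.2 ?_) ?_
      · rintro _ ⟨i, rfl⟩
        exact (w.1 i).2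
      · rw [finrank_span_eq_card hw, hA, Fintype.card_fin]
    exact ⟨hw, by rwa [hs]⟩
  · have hw : LinearIndependent F (fun i => (w.1 i : V)) :=
      w.2.map' A.subtype A.ker_subtype
    refine Subtype.ext (eq_of_le_of_finrank_eq (span_le.2 ?_) ?_)
    · rintro _ ⟨i, rfl⟩
      exact (w.1 i).2
    · rw [finrank_span_eq_card hw, hA, Fintype.card_fin]

theorem card_submodule_finrank_eq (k : ℕ) (hk : k ≤ finrank F V) :
    Nat.card {A : Submodule F V // finrank F A = k} *
        ∏ i ∈ Finset.range k, (Nat.card F ^ k - Nat.card F ^ i) =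
      ∏ i ∈ Finset.range k, (Nat.card F ^ finrank F V - Nat.card F ^ i) := by
  have h := card_frames_span (F := F) (V := V) k (fun _ => True)
  simp only [and_true] at h
  rw [← h, card_frames hk]

/-- Subspaces between `E` and `D` correspond, by modularity, to the subspaces of a complement of
`E` in `D`. -/
theorem card_submodule_between {D E : Submodule F V} (h : E ≤ D) (l : ℕ)
    (hl : finrank F E + l ≤ finrank F D) :
    Nat.card {B : Submodule F V // finrank F B = finrank F E + l ∧ E ≤ B ∧ B ≤ D} *
        ∏ i ∈ Finset.range l, (Nat.card F ^ l - Nat.card F ^ i) =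
      ∏ i ∈ Finset.range l, (Nat.card F ^ (finrank F D - finrank F E) - Nat.card F ^ i) := by
  obtain ⟨K, hK⟩ := Submodule.exists_isCompl (E.submoduleOf D)
  have hE : finrank F (E.submoduleOf D) = finrank F E :=
    (submoduleOfEquivOfLe h).finrank_eq
  have hKd : finrank F K = finrank F D - finrank F E := by
    have := finrank_add_eq_of_isCompl hK
    omega
  rw [← hKd, ← card_submodule_finrank_eq (F := F) (V := K) l (by omega)]
  congr 1
  -- `K ≥ K' ↦ K' ⊔ E`, seen inside `D`
  have key : ∀ X : Set.Iic K, finrank F (X.1 ⊔ E.submoduleOf D : Submodule F D) =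
      finrank F X.1 + finrank F E := by
    intro X
    have h1 := finrank_sup_add_finrank_inf_eq X.1 (E.submoduleOf D)
    have h2 : X.1 ⊓ E.submoduleOf D = ⊥ :=
      (hK.symm.disjoint.mono_left X.2).eq_bot
    rw [h2, finrank_bot, hE] at h1
    omega
  refine Nat.card_congr ?_
  have e1 : {B : Submodule F V // finrank F B = finrank F E + l ∧ E ≤ B ∧ B ≤ D} ≃
      {B : Set.Ici (E.submoduleOf D) // finrank F B.1 = finrank F E + l} :=
    { toFun := fun B => ⟨⟨B.1.submoduleOf D, comap_mono B.2.2.1⟩,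
        (submoduleOfEquivOfLe B.2.2.2).finrank_eq.trans B.2.1⟩
      invFun := fun B => ⟨B.1.1.map D.subtype, by
          rw [finrank_map_subtype_eq, B.2], by
          exact (map_comap_eq_of_le (f := D.subtype) (p := E) (by simpa using h)).ge.trans
            (map_mono B.1.2), map_subtype_le _ _⟩
      left_inv := fun B => Subtype.ext (map_comap_eq_of_le (by simpa using B.2.2.2))
      right_inv := fun B => Subtype.ext (Subtype.ext
        (comap_map_eq_of_injective D.injective_subtype _)) }
  have e2 : {X : Set.Iic K // finrank F X.1 = l} ≃
      {B : Set.Ici (E.submoduleOf D) // finrank F B.1 = finrank F E + l} :=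
    hK.symm.IicOrderIsoIci.toEquiv.subtypeEquiv (fun X => by
      change _ ↔ finrank F (X.1 ⊔ E.submoduleOf D : Submodule F D) = _
      rw [key]
      omega)
  have e3 : {A : Submodule F K // finrank F A = l} ≃ {X : Set.Iic K // finrank F X.1 = l} :=
    (mapIic K).toEquiv.subtypeEquiv (fun A => by
      change _ ↔ finrank F (A.map K.subtype) = _
      rw [finrank_map_subtype_eq])
  exact e1.trans (e3.trans e2).symm

end Frames

/-! ### Totally isotropic subspaces of an alternating form -/

section Alternating

variable {F V : Type*} [Field F] [AddCommGroup V] [Module F V]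
  {b : LinearMap.BilinForm F V}

theorem ker_le_orthogonal (hb : b.IsAlt) (A : Submodule F V) :
    LinearMap.ker b ≤ b.orthogonal A := by
  rw [← LinearMap.BilinForm.orthogonal_top_eq_ker hb.isRefl]
  exact LinearMap.BilinForm.orthogonal_le le_top

theorem sup_span_singleton_le_orthogonal_iff (hb : b.IsAlt) (A : Submodule F V) (x : V) :
    span F {x} ⊔ A ≤ b.orthogonal (span F {x} ⊔ A) ↔ A ≤ b.orthogonal A ∧ x ∈ b.orthogonal A := by
  constructor
  · intro h
    have hA : A ≤ span F {x} ⊔ A := le_sup_right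
    have hx : x ∈ span F {x} ⊔ A :=
      le_sup_left (a := span F {x}) (mem_span_singleton_self x)
    exact ⟨fun y hy z hz => h (hA hy) z (hA hz), fun z hz => h hx z (hA hz)⟩
  · rintro ⟨h, hx⟩ y hy z hz
    obtain ⟨_, hy1, y2, hy2, rfl⟩ := mem_sup.1 hy
    obtain ⟨_, hz1, z2, hz2, rfl⟩ := mem_sup.1 hz
    obtain ⟨c, rfl⟩ := mem_span_singleton.1 hy1
    obtain ⟨d, rfl⟩ := mem_span_singleton.1 hz1
    have h1 : b z2 y2 = 0 := h hy2 z2 hz2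
    have h2 : b z2 x = 0 := hx z2 hz2
    have h3 : b x y2 = 0 := hb.isRefl _ _ (hx y2 hy2)
    change b _ _ = 0
    simp [h1, h2, h3, hb x]

/-- Both sides say that `x ≠ 0` and that `A`, `U` and the line through `x` are independent. -/
theorem disjoint_sup_span_singleton_iff {A U : Submodule F V} {x : V} :
    (x ∉ A ∧ Disjoint (span F {x} ⊔ A) U) ↔ (Disjoint A U ∧ x ∉ A ⊔ U) := by
  constructor
  · rintro ⟨hx, h⟩
    refine ⟨h.mono_left le_sup_right, fun hxAU => ?_⟩
    obtain ⟨y, hy, z, hz, rfl⟩ := mem_sup.1 hxAU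
    have hz' : z ∈ span F {y + z} ⊔ A := by
      have h1 : y + z ∈ span F {y + z} ⊔ A :=
        le_sup_left (a := span F {y + z}) (mem_span_singleton_self _)
      have h2 := sub_mem h1 (le_sup_right (a := span F {y + z}) hy)
      simpa using h2
    have hz0 : z = 0 := disjoint_def.1 h z hz' hz
    rw [hz0, add_zero] at hx
    exact hx hy
  · rintro ⟨h, hx⟩
    refine ⟨fun hxA => hx (le_sup_left (a := A) hxA), ?_⟩
    refine Disjoint.disjoint_sup_left_of_disjoint_sup_right h ?_
    refine Disjoint.symm (disjoint_span_singleton.2 fun hx' => absurd hx' hx)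

theorem ker_restrict_eq_bot_of_isCompl (hb : b.IsAlt) {K : Submodule F V}
    (hK : IsCompl K (LinearMap.ker b)) : LinearMap.ker (b.restrict K) = ⊥ := by
  refine _root_.eq_bot_iff.2 fun x hx => ?_
  have hx' : (x : V) ∈ LinearMap.ker b := by
    refine LinearMap.ext fun y => ?_
    obtain ⟨s, hs, t, ht, rfl⟩ := mem_sup.1 (hK.sup_eq_top ▸ mem_top : y ∈ K ⊔ LinearMap.ker b)
    have h1 : b x s = 0 := LinearMap.congr_fun hx ⟨s, hs⟩
    have h2 : b x t = 0 := hb.isRefl _ _ (by rw [LinearMap.mem_ker.1 ht]; rfl)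
    simp [h1, h2]
  have := disjoint_def.1 hK.disjoint x x.2 hx'
  simpa using this

variable [Finite V]

theorem finrank_orthogonal_of_disjoint_ker (hb : b.IsAlt) {A : Submodule F V}
    (hA : Disjoint A (LinearMap.ker b)) :
    finrank F (b.orthogonal A) = finrank F V - finrank F A := by
  have h := LinearMap.BilinForm.finrank_add_finrank_orthogonal hb.isRefl A
  rw [LinearMap.BilinForm.orthogonal_top_eq_ker hb.isRefl, hA.eq_bot, finrank_bot] at h
  omega

/-- A `k`-frame spanning a totally isotropic subspace `A` that avoids the radical `U` is extended
by the vectors of `A^⊥` outside `A ⊕ U`; their number depends on `k` only. Where the subtractions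
truncate there is no such frame and both sides vanish. -/
theorem card_isotropic_frames [Finite F] (hb : b.IsAlt) (k : ℕ) :
    Nat.card {v : Fin k → V // LinearIndependent F v ∧
        (span F (Set.range v) ≤ b.orthogonal (span F (Set.range v)) ∧
          Disjoint (span F (Set.range v)) (LinearMap.ker b))} =
      ∏ i ∈ Finset.range k, (Nat.card F ^ (finrank F V - i) -
        Nat.card F ^ (finrank F (LinearMap.ker b) + i)) := by
  induction k with
  | zero =>
    rw [Finset.prod_range_zero, Nat.card_eq_one_iff_unique]
    refine ⟨⟨fun v w => Subtype.ext (Subsingleton.elim _ _)⟩, ⟨⟨Fin.elim0, ?_⟩⟩⟩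
    simp
  | succ k ih =>
    have hext : ∀ (x : V) (v : Fin k → V),
        (LinearIndependent F (Fin.cons x v : Fin (k + 1) → V) ∧
        (span F (Set.range (Fin.cons x v : Fin (k + 1) → V)) ≤
            b.orthogonal (span F (Set.range (Fin.cons x v : Fin (k + 1) → V))) ∧
          Disjoint (span F (Set.range (Fin.cons x v : Fin (k + 1) → V))) (LinearMap.ker b))) ↔
        (LinearIndependent F v ∧ (span F (Set.range v) ≤ b.orthogonal (span F (Set.range v)) ∧
          Disjoint (span F (Set.range v)) (LinearMap.ker b))) ∧
          (x ∈ b.orthogonal (span F (Set.range v)) ∧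
            x ∉ span F (Set.range v) ⊔ LinearMap.ker b) := by
      intro x v
      rw [linearIndependent_finCons, Fin.range_cons, span_insert,
        sup_span_singleton_le_orthogonal_iff hb]
      have := disjoint_sup_span_singleton_iff (A := span F (Set.range v))
        (U := LinearMap.ker b) (x := x)
      tauto
    rw [Finset.prod_range_succ, ← ih]
    refine card_eq_card_mul_of_card_fiber
      (fun v => ⟨Fin.tail v.1, ((hext (v.1 0) (Fin.tail v.1)).1
        (by rw [Fin.cons_self_tail]; exact v.2)).1⟩) _ ?_
    rintro ⟨v, hv⟩
    have hle : span F (Set.range v) ⊔ LinearMap.ker b ≤ b.orthogonal (span F (Set.range v)) :=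
      sup_le hv.2.1 (ker_le_orthogonal hb _)
    have hc := card_mem_notMem hle
    rw [finrank_orthogonal_of_disjoint_ker hb hv.2.2] at hc
    have hs := finrank_sup_add_finrank_inf_eq (span F (Set.range v)) (LinearMap.ker b)
    rw [hv.2.2.eq_bot, finrank_bot, add_zero] at hs
    rw [hs, finrank_span_eq_card hv.1, Fintype.card_fin, add_comm k] at hc
    rw [← hc]
    refine Nat.card_congr
      { toFun := fun w => ⟨w.1.1 0, ?_⟩
        invFun := fun x => ⟨⟨Fin.cons x.1 v, (hext x.1 v).2 ⟨hv, x.2⟩⟩,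
          Subtype.ext (Fin.tail_cons (α := fun _ => V) x.1 v)⟩
        left_inv := fun w => ?_
        right_inv := fun x => rfl }
    · have hw : Fin.tail w.1.1 = v := congrArg Subtype.val w.2
      have hcons : (Fin.cons (w.1.1 0) v : Fin (k + 1) → V) = w.1.1 :=
        (congrArg (Fin.cons (α := fun _ => V) (w.1.1 0)) hw.symm).trans (Fin.cons_self_tail _)
      refine ((hext (w.1.1 0) v).1 ?_).2
      rw [hcons]
      exact w.1.2
    · have hw : Fin.tail w.1.1 = v := congrArg Subtype.val w.2
      exact Subtype.ext (Subtype.ext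
        ((congrArg (Fin.cons (α := fun _ => V) (w.1.1 0)) hw.symm).trans (Fin.cons_self_tail _)))

theorem card_isotropic_disjoint_ker [Finite F] (hb : b.IsAlt) (k : ℕ) :
    Nat.card {A : Submodule F V // finrank F A = k ∧
        (A ≤ b.orthogonal A ∧ Disjoint A (LinearMap.ker b))} *
        ∏ i ∈ Finset.range k, (Nat.card F ^ k - Nat.card F ^ i) =
      ∏ i ∈ Finset.range k, (Nat.card F ^ (finrank F V - i) -
        Nat.card F ^ (finrank F (LinearMap.ker b) + i)) := by
  rw [← card_isotropic_frames hb k, card_frames_span k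
    (fun A => A ≤ b.orthogonal A ∧ Disjoint A (LinearMap.ker b))]

/-- The totally isotropic subspaces containing the radical correspond to those of a complement of
the radical, on which the form is nondegenerate. -/
theorem card_isotropic_ker_le [Finite F] (hb : b.IsAlt) (k : ℕ) :
    Nat.card {A : Submodule F V // finrank F A = k + finrank F (LinearMap.ker b) ∧
        (A ≤ b.orthogonal A ∧ LinearMap.ker b ≤ A)} *
        ∏ i ∈ Finset.range k, (Nat.card F ^ k - Nat.card F ^ i) =
      ∏ i ∈ Finset.range k, (Nat.card F ^ (finrank F V - finrank F (LinearMap.ker b) - i) -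
        Nat.card F ^ i) := by
  obtain ⟨K, hK⟩ := Submodule.exists_isCompl (LinearMap.ker b)
  have hKd := finrank_add_eq_of_isCompl hK
  have hbK : (b.restrict K).IsAlt := fun x => hb x
  have h := card_isotropic_disjoint_ker hbK k
  rw [ker_restrict_eq_bot_of_isCompl hb hK.symm, finrank_bot] at h
  simp only [disjoint_bot_right, and_true, zero_add] at h
  rw [show finrank F V - finrank F (LinearMap.ker b) = finrank F K by omega, ← h]
  congr 1
  have hiso : ∀ X : Submodule F V,
      X ⊔ LinearMap.ker b ≤ b.orthogonal (X ⊔ LinearMap.ker b) ↔ X ≤ b.orthogonal X := by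
    refine fun X => ⟨fun h x hx y hy =>
      h (le_sup_left (b := LinearMap.ker b) hx) y (le_sup_left (b := LinearMap.ker b) hy),
      fun h x hx y hy => ?_⟩
    obtain ⟨x1, hx1, x2, hx2, rfl⟩ := mem_sup.1 hx
    obtain ⟨y1, hy1, y2, hy2, rfl⟩ := mem_sup.1 hy
    have h1 : b y1 x1 = 0 := h hx1 y1 hy1
    have h2 : b y1 x2 = 0 := hb.isRefl _ _ (by rw [LinearMap.mem_ker.1 hx2]; rfl)
    have h3 : b y2 = 0 := hy2
    change b _ _ = 0
    simp [h1, h2, h3]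
  have e2 : {X : Set.Iic K // finrank F X.1 = k ∧ X.1 ≤ b.orthogonal X.1} ≃
      {B : Set.Ici (LinearMap.ker b) // finrank F B.1 = k + finrank F (LinearMap.ker b) ∧
        B.1 ≤ b.orthogonal B.1} :=
    hK.symm.IicOrderIsoIci.toEquiv.subtypeEquiv (fun X => by
      change _ ↔ finrank F (X.1 ⊔ LinearMap.ker b : Submodule F V) = _ ∧
        X.1 ⊔ LinearMap.ker b ≤ b.orthogonal (X.1 ⊔ LinearMap.ker b)
      have h1 := finrank_sup_add_finrank_inf_eq X.1 (LinearMap.ker b)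
      rw [(hK.symm.disjoint.mono_left X.2).eq_bot, finrank_bot] at h1
      rw [hiso]
      refine and_congr_left fun _ => ?_
      omega)
  have e3 : {A : Submodule F K // finrank F A = k ∧ A ≤ (b.restrict K).orthogonal A} ≃
      {X : Set.Iic K // finrank F X.1 = k ∧ X.1 ≤ b.orthogonal X.1} :=
    (mapIic K).toEquiv.subtypeEquiv (fun A => by
      change _ ↔ finrank F (A.map K.subtype) = _ ∧ A.map K.subtype ≤ b.orthogonal (A.map K.subtype)
      rw [finrank_map_subtype_eq]
      refine and_congr_right fun _ => ⟨?_, fun h x hx y hy =>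
        h (mem_map_of_mem hx) (y : V) (mem_map_of_mem (f := K.subtype) hy)⟩
      rintro h _ ⟨x, hx, rfl⟩ _ ⟨y, hy, rfl⟩
      exact h hx y hy)
  have e1 : {A : Submodule F V // finrank F A = k + finrank F (LinearMap.ker b) ∧
        (A ≤ b.orthogonal A ∧ LinearMap.ker b ≤ A)} ≃
      {B : Set.Ici (LinearMap.ker b) // finrank F B.1 = k + finrank F (LinearMap.ker b) ∧
        B.1 ≤ b.orthogonal B.1} :=
    { toFun := fun A => ⟨⟨A.1, A.2.2.2⟩, A.2.1, A.2.2.1⟩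
      invFun := fun B => ⟨B.1.1, B.2.1, B.2.2, B.1.2⟩
      left_inv := fun _ => rfl
      right_inv := fun _ => rfl }
  exact Nat.card_congr (e1.trans (e3.trans e2).symm)

end Alternating

/-! ### Products of differences of powers -/

theorem prod_pow_sub_pow (q : ℚ) (d r k : ℕ) (h : ∀ i < k, r + 2 * i ≤ d) :
    ∏ i ∈ Finset.range k, (q ^ (d - i) - q ^ (r + i)) =
      q ^ (r * k + ∑ i ∈ Finset.range k, i) *
        ∏ i ∈ Finset.range k, (q ^ (d - r - 2 * i) - 1) := by
  have hf : ∀ i ∈ Finset.range k,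
      q ^ (d - i) - q ^ (r + i) = q ^ (r + i) * (q ^ (d - r - 2 * i) - 1) := by
    intro i hi
    have := h i (Finset.mem_range.1 hi)
    rw [mul_sub, mul_one, ← pow_add]
    congr 2
    omega
  rw [Finset.prod_congr rfl hf, Finset.prod_mul_distrib, Finset.prod_pow_eq_pow_sum,
    Finset.sum_add_distrib, Finset.sum_const, Finset.card_range, smul_eq_mul, mul_comm k]

/-- The `i`-th factor is `q ^ i * (q ^ (k - i) - 1)`; the second parts are reindexed in reverse. -/
theorem prod_pow_card_sub_pow (q : ℚ) (k : ℕ) :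
    ∏ i ∈ Finset.range k, (q ^ k - q ^ i) =
      q ^ (∑ i ∈ Finset.range k, i) * ∏ i ∈ Finset.range k, (q ^ (i + 1) - 1) := by
  have hf : ∀ i ∈ Finset.range k, q ^ k - q ^ i = q ^ i * (q ^ (k - 1 - i + 1) - 1) := by
    intro i hi
    have := Finset.mem_range.1 hi
    rw [mul_sub, mul_one, ← pow_add]
    congr 2
    omega
  rw [Finset.prod_congr rfl hf, Finset.prod_mul_distrib, Finset.prod_pow_eq_pow_sum,
    Finset.prod_range_reflect (fun i => q ^ (i + 1) - 1) k]

theorem cast_prod_pow_sub_pow {q : ℕ} (hq : 1 < q) {k : ℕ} (f g : ℕ → ℕ)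
    (h : ∀ i < k, g i ≤ f i) :
    ((∏ i ∈ Finset.range k, (q ^ f i - q ^ g i) : ℕ) : ℚ) =
      ∏ i ∈ Finset.range k, ((q : ℚ) ^ f i - (q : ℚ) ^ g i) := by
  rw [Nat.cast_prod]
  refine Finset.prod_congr rfl fun i hi => ?_
  rw [Nat.cast_sub (Nat.pow_le_pow_right hq.le (h i (Finset.mem_range.1 hi)))]
  simp

theorem prod_pow_card_sub_pow_ne_zero {q : ℕ} (hq : 1 < q) (k : ℕ) :
    ∏ i ∈ Finset.range k, ((q : ℚ) ^ k - (q : ℚ) ^ i) ≠ 0 := by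
  refine Finset.prod_ne_zero_iff.2 fun i hi => ?_
  exact (sub_pos.2 (pow_lt_pow_right₀ (by exact_mod_cast hq) (Finset.mem_range.1 hi))).ne'

theorem cast_eq_gaussBinom {q : ℕ} (hq : 1 < q) {N a b : ℕ} (hab : b ≤ a)
    (h : N * ∏ i ∈ Finset.range b, (q ^ b - q ^ i) = ∏ i ∈ Finset.range b, (q ^ a - q ^ i)) :
    (N : ℚ) = gaussBinom q a b := by
  have h' := congrArg (Nat.cast : ℕ → ℚ) h
  rw [Nat.cast_mul, cast_prod_pow_sub_pow hq _ _ fun i hi => hi.le,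
    cast_prod_pow_sub_pow hq _ _ fun i hi => (hi.le.trans hab)] at h'
  rw [gaussBinom, Finset.prod_div_distrib, ← h',
    mul_div_cancel_right₀ _ (prod_pow_card_sub_pow_ne_zero hq b)]

/-- Evaluation of a count of subspaces by frames. The natural subtractions in the hypothesis `h` do
not truncate in the range allowed by `hd`. -/
theorem cast_eq_prod_div {q : ℕ} (hq : 1 < q) {N d r k : ℕ} (hd : ∀ i < k, r + 2 * i ≤ d)
    (h : N * ∏ i ∈ Finset.range k, (q ^ k - q ^ i) =
      ∏ i ∈ Finset.range k, (q ^ (d - i) - q ^ (r + i))) :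
    (N : ℚ) = (q : ℚ) ^ (r * k) *
      ∏ i ∈ Finset.range k, ((q : ℚ) ^ (d - r - 2 * i) - 1) / ((q : ℚ) ^ (i + 1) - 1) := by
  have h' := congrArg (Nat.cast : ℕ → ℚ) h
  have h0 := prod_pow_card_sub_pow_ne_zero hq k
  rw [Nat.cast_mul, cast_prod_pow_sub_pow hq _ _ fun i hi => hi.le,
    cast_prod_pow_sub_pow hq _ _ fun i hi => (by have := hd i hi; omega),
    prod_pow_sub_pow _ _ _ _ hd] at h'
  rw [prod_pow_card_sub_pow] at h' h0
  rw [Finset.prod_div_distrib, ← mul_div_assoc, eq_div_iff (right_ne_zero_of_mul h0)]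
  -- both counts carry the common factor `q ^ (0 + 1 + ⋯ + (k - 1))`
  refine mul_left_cancel₀ (left_ne_zero_of_mul h0) ?_
  rw [← mul_assoc, mul_comm _ (N : ℚ), mul_assoc, h', pow_add]
  ring

/-! ### Self-orthogonal subspaces of `F ^ n` in characteristic two -/

section DotProduct

variable (F : Type*) [Field F] (n : ℕ)

/-- The hyperplane of vectors with coordinate sum zero. -/
def sumZero : Submodule F (Fin n → F) :=
  LinearMap.ker (Fintype.linearCombination F (fun _ : Fin n => (1 : F)))

/-- The dot product restricted to the hyperplane of vectors with coordinate sum zero. -/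
def sumZeroForm : LinearMap.BilinForm F (sumZero F n) :=
  LinearMap.BilinForm.restrict (dotProductBilin F F) (sumZero F n)

variable {F n}

theorem mem_sumZero {x : Fin n → F} : x ∈ sumZero F n ↔ ∑ i, x i = 0 := by
  simp [sumZero, Fintype.linearCombination_apply]

theorem sumZeroForm_apply (x y : sumZero F n) : sumZeroForm F n x y = (x : Fin n → F) ⬝ᵥ y := rfl

theorem dotProduct_self_eq_sum_sq [CharP F 2] (x : Fin n → F) : x ⬝ᵥ x = (∑ i, x i) ^ 2 := by
  simp only [dotProduct, sq]
  exact (CharTwo.sum_mul_self _ _).symm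

theorem sumZeroForm_isAlt [CharP F 2] : (sumZeroForm F n).IsAlt := by
  intro x
  rw [sumZeroForm_apply, dotProduct_self_eq_sum_sq, mem_sumZero.1 x.2]
  simp

theorem finrank_sumZero (hn : 0 < n) : finrank F (sumZero F n) = n - 1 := by
  have hs : LinearMap.range (Fintype.linearCombination F (fun _ : Fin n => (1 : F))) = ⊤ := by
    refine LinearMap.range_eq_top.2 fun c => ⟨Pi.single ⟨0, hn⟩ c, ?_⟩
    simp [Fintype.linearCombination_apply]
  have h := LinearMap.finrank_range_add_finrank_ker
    (Fintype.linearCombination F (fun _ : Fin n => (1 : F)))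
  rw [hs, finrank_top, finrank_self, finrank_fin_fun] at h
  unfold sumZero
  omega

/-- A radical vector is orthogonal to all differences of unit vectors, hence constant. -/
theorem mem_ker_sumZeroForm (x : sumZero F n) :
    x ∈ LinearMap.ker (sumZeroForm F n) ↔ ∀ i j, (x : Fin n → F) i = (x : Fin n → F) j := by
  constructor
  · intro hx i j
    have hy : (Pi.single i 1 - Pi.single j 1 : Fin n → F) ∈ sumZero F n := by
      simp [mem_sumZero]
    have h := LinearMap.congr_fun (LinearMap.mem_ker.1 hx) ⟨_, hy⟩
    rw [sumZeroForm_apply] at h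
    simpa [dotProduct_sub, sub_eq_zero] using h
  · intro hx
    refine LinearMap.ext fun y => ?_
    rw [sumZeroForm_apply]
    rcases Nat.eq_zero_or_pos n with rfl | hn
    · simp
    · have h : (x : Fin n → F) = fun _ => (x : Fin n → F) ⟨0, hn⟩ := funext fun i => hx _ _
      rw [h, dotProduct, ← Finset.mul_sum, mem_sumZero.1 y.2]
      simp

theorem ker_sumZeroForm_of_odd [CharP F 2] (hn : Odd n) :
    LinearMap.ker (sumZeroForm F n) = ⊥ := by
  refine _root_.eq_bot_iff.2 fun x hx => ?_
  rw [mem_ker_sumZeroForm] at hx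
  refine (mem_bot F).2 (Subtype.ext (funext fun i => ?_))
  have h := mem_sumZero.1 x.2
  rw [Finset.sum_congr rfl fun j _ => hx j i, Finset.sum_const, Finset.card_univ,
    Fintype.card_fin, nsmul_eq_mul, CharTwo.natCast_eq_ite, if_neg (by simpa using hn)] at h
  simpa using h

theorem finrank_ker_sumZeroForm_of_even [CharP F 2] (hn : Even n) (hn0 : 0 < n) :
    finrank F (LinearMap.ker (sumZeroForm F n)) = 1 := by
  have h1 : (fun _ => 1 : Fin n → F) ∈ sumZero F n := by
    rw [mem_sumZero, Finset.sum_const, Finset.card_univ, Fintype.card_fin, nsmul_eq_mul,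
      CharTwo.natCast_eq_ite, if_pos hn, zero_mul]
  refine finrank_eq_one (⟨⟨_, h1⟩, (mem_ker_sumZeroForm _).2 fun i j => rfl⟩ :
    LinearMap.ker (sumZeroForm F n)) ?_ ?_
  · intro h
    have := congrFun (congrArg (fun x => x.1.1) h) ⟨0, hn0⟩
    simp at this
  · rintro ⟨x, hx⟩
    rw [mem_ker_sumZeroForm] at hx
    refine ⟨x.1 ⟨0, hn0⟩, Subtype.ext (Subtype.ext (funext fun i => ?_))⟩
    simp [hx i ⟨0, hn0⟩]

/-- In characteristic two `x ⬝ᵥ x = (∑ i, x i) ^ 2`, so a self-orthogonal subspace consists of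
vectors with coordinate sum zero. -/
theorem card_selfOrthogonal_eq_card_isotropic [CharP F 2] (k : ℕ) :
    Nat.card {A : Submodule F (Fin n → F) // finrank F A = k ∧ ∀ x ∈ A, ∀ y ∈ A, x ⬝ᵥ y = 0} =
      Nat.card {A : Submodule F (sumZero F n) // finrank F A = k ∧
        A ≤ (sumZeroForm F n).orthogonal A} := by
  have e1 : {A : Submodule F (sumZero F n) // finrank F A = k ∧
        A ≤ (sumZeroForm F n).orthogonal A} ≃
      {A : Set.Iic (sumZero F n) // finrank F A.1 = k ∧ ∀ x ∈ A.1, ∀ y ∈ A.1, x ⬝ᵥ y = 0} :=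
    (mapIic (sumZero F n)).toEquiv.subtypeEquiv (fun A => by
      change _ ↔ finrank F (A.map (sumZero F n).subtype) = _ ∧
        ∀ x ∈ A.map (sumZero F n).subtype, ∀ y ∈ A.map (sumZero F n).subtype, x ⬝ᵥ y = 0
      rw [finrank_map_subtype_eq]
      refine and_congr_right fun _ => ⟨?_, fun h x hx y hy =>
        h _ (mem_map_of_mem (f := (sumZero F n).subtype) hy) _
          (mem_map_of_mem (f := (sumZero F n).subtype) hx)⟩
      rintro h _ ⟨x, hx, rfl⟩ _ ⟨y, hy, rfl⟩
      exact h hy x hx)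
  refine Nat.card_congr (Equiv.trans ?_ e1.symm)
  exact
    { toFun := fun A => ⟨⟨A.1, fun x hx => by
        have h := A.2.2 x hx x hx
        rw [dotProduct_self_eq_sum_sq] at h
        exact mem_sumZero.2 (pow_eq_zero_iff two_ne_zero |>.1 h)⟩, A.2⟩
      invFun := fun A => ⟨A.1.1, A.2⟩
      left_inv := fun _ => rfl
      right_inv := fun _ => rfl }

theorem card_selfOrthogonal_of_odd [Finite F] [CharP F 2] (hn : Odd n) {k : ℕ} (hk : 2 * k ≤ n) :
    (Nat.card {A : Submodule F (Fin n → F) // finrank F A = k ∧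
        ∀ x ∈ A, ∀ y ∈ A, x ⬝ᵥ y = 0} : ℚ) =
      ∏ i ∈ Finset.range k,
        ((Nat.card F : ℚ) ^ (n - 1 - 2 * i) - 1) / ((Nat.card F : ℚ) ^ (i + 1) - 1) := by
  have hq : 1 < Nat.card F := Finite.one_lt_card
  have h := card_isotropic_disjoint_ker (sumZeroForm_isAlt (F := F) (n := n)) k
  rw [ker_sumZeroForm_of_odd hn, finrank_bot, finrank_sumZero hn.pos] at h
  simp only [disjoint_bot_right, and_true] at h
  rw [card_selfOrthogonal_eq_card_isotropic, cast_eq_prod_div hq (fun i hi => by omega) h]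
  simp

/-- For even `n` the radical is the line of constant vectors. A totally isotropic subspace either
avoids it or contains it, and the two counts add up. -/
theorem card_selfOrthogonal_of_even [Finite F] [CharP F 2] (hn : Even n) {k : ℕ} (hk0 : 0 < k)
    (hk : 2 * k ≤ n) :
    (Nat.card {A : Submodule F (Fin n → F) // finrank F A = k ∧
        ∀ x ∈ A, ∀ y ∈ A, x ⬝ᵥ y = 0} : ℚ) =
      (((Nat.card F : ℚ) ^ (n - k) - 1) / ((Nat.card F : ℚ) ^ k - 1)) *
      ∏ i ∈ Finset.range (k - 1),
        ((Nat.card F : ℚ) ^ (n - 2 - 2 * i) - 1) / ((Nat.card F : ℚ) ^ (i + 1) - 1) := by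
  classical
  have hq : 1 < Nat.card F := Finite.one_lt_card
  have hn0 : 0 < n := by omega
  obtain ⟨k, rfl⟩ := Nat.exists_eq_succ_of_ne_zero hk0.ne'
  have hr := finrank_ker_sumZeroForm_of_even (F := F) hn hn0
  have hatom : IsAtom (LinearMap.ker (sumZeroForm F n)) := by
    exact isAtom_iff_finrank_eq_one.2 hr
  have h1 := card_isotropic_disjoint_ker (sumZeroForm_isAlt (F := F) (n := n)) (k + 1)
  have h2 := card_isotropic_ker_le (sumZeroForm_isAlt (F := F) (n := n)) k
  rw [hr, finrank_sumZero hn0] at h1 h2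
  have h1' := cast_eq_prod_div hq (fun i hi => by omega) h1
  have h2' := cast_eq_prod_div (r := 0) (d := n - 1 - 1) (k := k) hq (fun i hi => by omega)
    (by simpa using h2)
  rw [card_selfOrthogonal_eq_card_isotropic]
  have hsplit : Nat.card {A : Submodule F (sumZero F n) // finrank F A = k + 1 ∧
        A ≤ (sumZeroForm F n).orthogonal A} =
      Nat.card {A : Submodule F (sumZero F n) // finrank F A = k + 1 ∧
        (A ≤ (sumZeroForm F n).orthogonal A ∧ Disjoint A (LinearMap.ker (sumZeroForm F n)))} +
      Nat.card {A : Submodule F (sumZero F n) // finrank F A = k + 1 ∧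
        (A ≤ (sumZeroForm F n).orthogonal A ∧ LinearMap.ker (sumZeroForm F n) ≤ A)} := by
    rw [← Nat.card_sum, ← Nat.card_congr (subtypeOrEquiv _ _ ?_)]
    · refine Nat.card_congr (Equiv.subtypeEquivRight fun A => ?_)
      have := hatom.not_le_iff_disjoint (b := A)
      rw [disjoint_comm] at this
      tauto
    · rw [Pi.disjoint_iff]
      intro A
      rw [Prop.disjoint_iff]
      -- a subspace containing the radical and disjoint from it would make the radical trivial
      exact fun hA => hatom.1 (disjoint_self.1 (hA.1.2.2.mono_left hA.2.2.2))
  rw [hsplit, Nat.cast_add, h1', h2', Finset.prod_range_succ]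
  have e1 : n - 1 - 1 = n - 2 := by omega
  have e2 : (Nat.card F : ℚ) ^ (n - (k + 1)) =
      (Nat.card F : ℚ) ^ (k + 1) * (Nat.card F : ℚ) ^ (n - 2 - 2 * k) := by
    rw [← pow_add]
    congr 1
    omega
  have h0 : (Nat.card F : ℚ) ^ (k + 1) - 1 ≠ 0 :=
    (sub_pos.2 (one_lt_pow₀ (by exact_mod_cast hq) (Nat.succ_ne_zero k))).ne'
  simp only [Nat.succ_eq_add_one, Nat.add_sub_cancel, e1, e2, zero_mul, pow_zero, one_mul,
    Nat.sub_zero]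
  field_simp
  ring

theorem card_selfOrthogonal [Finite F] [CharP F 2] {m : ℕ} (hm : Nat.card F = 2 ^ m) {k : ℕ}
    (hk : 2 * k ≤ n) :
    (Nat.card {A : Submodule F (Fin n → F) // finrank F A = k ∧
        ∀ x ∈ A, ∀ y ∈ A, x ⬝ᵥ y = 0} : ℚ) = numS m n k := by
  rw [numS]
  have hq : (Nat.card F : ℚ) = 2 ^ m := by rw [hm]; simp
  split_ifs with h1 h2
  · rw [card_selfOrthogonal_of_odd h1 hk]
    simp only [hq, pow_mul]
  · subst h2
    rw [Nat.cast_eq_one, Nat.card_eq_one_iff_unique]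
    refine ⟨⟨fun A B => Subtype.ext ?_⟩, ⟨⟨⊥, by simp⟩⟩⟩
    rw [finrank_eq_zero.1 A.2.1, finrank_eq_zero.1 B.2.1]
  · rw [card_selfOrthogonal_of_even (Nat.not_odd_iff_even.1 h1) (Nat.pos_of_ne_zero h2) hk]
    simp only [hq, pow_mul]

end DotProduct

/-! ### Codes over a ring of dual numbers -/

/-- `R` is the ring of dual numbers over `F` with `u` in the role of `ε`: it is the `F`-algebra
`F ⊕ u F` with `u ^ 2 = 0`. -/
structure IsDualNumberRing (F : Type*) {R : Type*} [Field F] [CommRing R] [Algebra F R] (u : R) :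
    Prop where
  mul_self : u * u = 0
  exists_eq : ∀ x : R, ∃ a b : F, x = algebraMap F R a + u * algebraMap F R b
  eq_zero : ∀ a b : F, algebraMap F R a + u * algebraMap F R b = 0 → a = 0 ∧ b = 0

section Codes

variable {F R : Type*} [Field F] [CommRing R] [Algebra F R] {n : ℕ}

/-- The vector `a + u b` over `R` attached to a pair `(a, b)` of vectors over `F`. -/
def pairVec (u : R) : (Fin n → F) × (Fin n → F) →ₗ[F] (Fin n → R) where
  toFun p i := algebraMap F R (p.1 i) + u * algebraMap F R (p.2 i)
  map_add' p q := by
    ext i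
    simp only [Prod.fst_add, Prod.snd_add, Pi.add_apply, map_add]
    ring
  map_smul' c p := by
    ext i
    simp only [Prod.smul_fst, Prod.smul_snd, Pi.smul_apply, smul_eq_mul, map_mul,
      RingHom.id_apply]
    rw [Algebra.smul_def]
    ring

theorem pairVec_apply (u : R) (p : (Fin n → F) × (Fin n → F)) (i : Fin n) :
    pairVec u p i = algebraMap F R (p.1 i) + u * algebraMap F R (p.2 i) := rfl

/-- The image of a code in the residue field. -/
def residueCode (F : Type*) [Field F] [Algebra F R] (u : R) (C : Submodule R (Fin n → R)) :
    Submodule F (Fin n → F) :=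
  map (LinearMap.fst F _ _) (comap (pairVec u) (C.restrictScalars F))

/-- The vectors `b` over the residue field with `u b` in the code. -/
def torsionCode (F : Type*) [Field F] [Algebra F R] (u : R) (C : Submodule R (Fin n → R)) :
    Submodule F (Fin n → F) :=
  comap (pairVec u ∘ₗ LinearMap.inr F _ _) (C.restrictScalars F)

/-- The code generated by `u B` and the vectors `aᵢ + u bᵢ`. Its torsion code is `B` when the `aᵢ`
are independent elements of `B`. -/
def liftCode {ι : Type*} (u : R) (a b : ι → Fin n → F) (B : Submodule F (Fin n → F)) :
    Submodule R (Fin n → R) :=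
  span R (Set.range (fun i => pairVec u (a i, b i)) ∪
    (fun β => pairVec u (0, β)) '' (B : Set (Fin n → F)))

variable {u : R}

theorem mem_residueCode {C : Submodule R (Fin n → R)} {a : Fin n → F} :
    a ∈ residueCode F u C ↔ ∃ b, pairVec u (a, b) ∈ C := by
  constructor
  · rintro ⟨⟨a, b⟩, h, rfl⟩
    exact ⟨b, h⟩
  · rintro ⟨b, h⟩
    exact ⟨(a, b), h, rfl⟩

theorem mem_torsionCode {C : Submodule R (Fin n → R)} {b : Fin n → F} :
    b ∈ torsionCode F u C ↔ pairVec u (0, b) ∈ C := Iff.rfl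

theorem algebraMap_smul_pairVec (s : F) (p : (Fin n → F) × (Fin n → F)) :
    algebraMap F R s • pairVec u p = pairVec u (s • p) := by
  rw [algebraMap_smul, map_smul]

namespace IsDualNumberRing

theorem smul_pairVec (hu : IsDualNumberRing F u) (s t : F) (a b : Fin n → F) :
    (algebraMap F R s + u * algebraMap F R t) • pairVec u (a, b) =
      pairVec u (s • a, s • b + t • a) := by
  ext i
  simp only [Pi.smul_apply, pairVec_apply, smul_eq_mul, Pi.add_apply, map_add, map_mul]
  linear_combination algebraMap F R t * algebraMap F R (b i) * hu.mul_self

theorem u_smul_pairVec (hu : IsDualNumberRing F u) (a b : Fin n → F) :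
    u • pairVec u (a, b) = pairVec u (0, a) := by
  have := hu.smul_pairVec 0 1 a b
  simpa using this

theorem exists_pairVec_eq (hu : IsDualNumberRing F u) (w : Fin n → R) :
    ∃ a b : Fin n → F, w = pairVec u (a, b) := by
  choose a b h using fun i => hu.exists_eq (w i)
  exact ⟨a, b, funext h⟩

theorem pairVec_injective (hu : IsDualNumberRing F u) :
    Function.Injective (pairVec (F := F) (n := n) u) := by
  refine (injective_iff_map_eq_zero _).2 fun p hp => ?_
  have h := fun i => hu.eq_zero _ _ (congrFun hp i)
  exact Prod.ext (funext fun i => (h i).1) (funext fun i => (h i).2)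

theorem pairVec_dotProduct (hu : IsDualNumberRing F u) (p q : (Fin n → F) × (Fin n → F)) :
    pairVec u p ⬝ᵥ pairVec u q = algebraMap F R (p.1 ⬝ᵥ q.1) +
      u * algebraMap F R (p.1 ⬝ᵥ q.2 + p.2 ⬝ᵥ q.1) := by
  simp only [dotProduct, map_add, map_sum, map_mul, mul_add, Finset.mul_sum,
    ← Finset.sum_add_distrib, pairVec_apply]
  refine Finset.sum_congr rfl fun i _ => ?_
  linear_combination algebraMap F R (p.2 i) * algebraMap F R (q.2 i) * hu.mul_self

theorem residueCode_le_torsionCode (hu : IsDualNumberRing F u) (C : Submodule R (Fin n → R)) :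
    residueCode F u C ≤ torsionCode F u C := by
  intro a ha
  obtain ⟨b, hb⟩ := mem_residueCode.1 ha
  rw [mem_torsionCode, ← hu.u_smul_pairVec a b]
  exact C.smul_mem u hb

theorem isSelfOrthogonal_iff (hu : IsDualNumberRing F u) (C : Submodule R (Fin n → R)) :
    IsSelfOrthogonal C ↔ ∀ p q : (Fin n → F) × (Fin n → F), pairVec u p ∈ C → pairVec u q ∈ C →
      p.1 ⬝ᵥ q.1 = 0 ∧ p.1 ⬝ᵥ q.2 + p.2 ⬝ᵥ q.1 = 0 := by
  constructor
  · intro h p q hp hq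
    refine hu.eq_zero _ _ ?_
    rw [← hu.pairVec_dotProduct]
    exact h hq _ hp
  · intro h w hw v hv
    obtain ⟨a, b, rfl⟩ := hu.exists_pairVec_eq w
    obtain ⟨c, d, rfl⟩ := hu.exists_pairVec_eq v
    have := h _ _ hv hw
    rw [hu.pairVec_dotProduct, this.1, this.2]
    simp

theorem residueCode_dotProduct_torsionCode (hu : IsDualNumberRing F u)
    {C : Submodule R (Fin n → R)} (hC : IsSelfOrthogonal C) {a b : Fin n → F}
    (ha : a ∈ residueCode F u C) (hb : b ∈ torsionCode F u C) : a ⬝ᵥ b = 0 := by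
  obtain ⟨c, hc⟩ := mem_residueCode.1 ha
  simpa using ((hu.isSelfOrthogonal_iff C).1 hC _ _ hc (mem_torsionCode.1 hb)).2

section Lift

variable {ι : Type*} {a b : ι → Fin n → F} {B : Submodule F (Fin n → F)}

theorem mem_liftCode [Fintype ι] (hu : IsDualNumberRing F u) (ha : ∀ i, a i ∈ B)
    {w : Fin n → R} :
    w ∈ liftCode u a b B ↔ ∃ x : ι → F, ∃ β ∈ B,
      w = pairVec u (∑ i, x i • a i, ∑ i, x i • b i + β) := by
  classical
  constructor
  · intro hw
    induction hw using span_induction with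
    | mem w hw =>
      rcases hw with ⟨i, rfl⟩ | ⟨β, hβ, rfl⟩
      · exact ⟨Pi.single i 1, 0, zero_mem _, by simp [Pi.single_apply]⟩
      · exact ⟨0, β, hβ, by simp⟩
    | zero => exact ⟨0, 0, zero_mem _, by simp [Prod.mk_zero_zero]⟩
    | add v w _ _ hv hw =>
      obtain ⟨x, β, hβ, rfl⟩ := hv
      obtain ⟨y, γ, hγ, rfl⟩ := hw
      refine ⟨x + y, β + γ, add_mem hβ hγ, ?_⟩
      rw [← map_add, Prod.mk_add_mk]
      simp only [Pi.add_apply, add_smul, Finset.sum_add_distrib]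
      congr 2
      abel
    | smul r w _ hw =>
      obtain ⟨x, β, hβ, rfl⟩ := hw
      obtain ⟨s, t, rfl⟩ := hu.exists_eq r
      refine ⟨s • x, s • β + t • ∑ i, x i • a i,
        add_mem (smul_mem _ _ hβ) (smul_mem _ _ (sum_mem fun i _ => smul_mem _ _ (ha i))), ?_⟩
      rw [hu.smul_pairVec]
      simp only [Pi.smul_apply, smul_assoc, ← Finset.smul_sum, smul_add, add_assoc]
  · rintro ⟨x, β, hβ, rfl⟩
    have h : pairVec u (∑ i, x i • a i, ∑ i, x i • b i + β) =
        ∑ i, algebraMap F R (x i) • pairVec u (a i, b i) + pairVec u (0, β) := by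
      simp only [algebraMap_smul_pairVec]
      rw [← map_sum, ← map_add]
      congr 1
      ext <;> simp [Prod.fst_sum, Prod.snd_sum]
    rw [h]
    exact add_mem (sum_mem fun i _ => smul_mem _ _ (subset_span (Or.inl ⟨i, rfl⟩)))
      (subset_span (Or.inr ⟨β, hβ, rfl⟩))

/-- A code is recovered from its torsion code and from lifts of generators of its residue code. -/
theorem liftCode_torsionCode [Fintype ι] (hu : IsDualNumberRing F u)
    {C : Submodule R (Fin n → R)} (ha : span F (Set.range a) = residueCode F u C)
    (hab : ∀ i, pairVec u (a i, b i) ∈ C) : liftCode u a b (torsionCode F u C) = C := by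
  refine le_antisymm (span_le.2 ?_) fun w hw => ?_
  · rintro _ (⟨i, rfl⟩ | ⟨β, hβ, rfl⟩)
    · exact hab i
    · exact hβ
  · obtain ⟨p, s, rfl⟩ := hu.exists_pairVec_eq w
    have hp : p ∈ span F (Set.range a) := ha ▸ mem_residueCode.2 ⟨s, hw⟩
    obtain ⟨x, rfl⟩ := (mem_span_range_iff_exists_fun F).1 hp
    refine (hu.mem_liftCode fun i => ?_).2 ⟨x, s - ∑ i, x i • b i, ?_, by simp⟩
    · exact hu.residueCode_le_torsionCode C (ha ▸ subset_span ⟨i, rfl⟩)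
    · rw [mem_torsionCode]
      have h : pairVec u (0, s - ∑ i, x i • b i) =
          pairVec u (∑ i, x i • a i, s) - ∑ i, algebraMap F R (x i) • pairVec u (a i, b i) := by
        simp only [algebraMap_smul_pairVec]
        rw [← map_sum, ← map_sub]
        congr 1
        ext <;> simp [Prod.fst_sum, Prod.snd_sum]
      rw [h]
      exact sub_mem hw (sum_mem fun i _ => smul_mem _ _ (hab i))

theorem residueCode_liftCode [Fintype ι] (hu : IsDualNumberRing F u) (ha : ∀ i, a i ∈ B) :
    residueCode F u (liftCode u a b B) = span F (Set.range a) := by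
  ext p
  rw [mem_residueCode, mem_span_range_iff_exists_fun]
  constructor
  · rintro ⟨s, hs⟩
    obtain ⟨x, β, -, h⟩ := (hu.mem_liftCode ha).1 hs
    exact ⟨x, (congrArg Prod.fst (hu.pairVec_injective h)).symm⟩
  · rintro ⟨x, rfl⟩
    exact ⟨_, (hu.mem_liftCode ha).2 ⟨x, 0, zero_mem _, rfl⟩⟩

theorem torsionCode_liftCode [Fintype ι] (hu : IsDualNumberRing F u) (ha : ∀ i, a i ∈ B)
    (hli : LinearIndependent F a) : torsionCode F u (liftCode u a b B) = B := by
  ext p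
  rw [mem_torsionCode]
  constructor
  · intro hp
    obtain ⟨x, β, hβ, h⟩ := (hu.mem_liftCode ha).1 hp
    have h' := hu.pairVec_injective h
    have hx : ∀ i, x i = 0 :=
      Fintype.linearIndependent_iff.1 hli x (congrArg Prod.fst h').symm
    have h2 : p = ∑ i, x i • b i + β := congrArg Prod.snd h'
    simp only [hx, zero_smul, Finset.sum_const_zero, zero_add] at h2
    exact h2 ▸ hβ
  · exact fun hp => subset_span (Or.inr ⟨p, hp, rfl⟩)

theorem pairVec_mem_liftCode (i : ι) : pairVec u (a i, b i) ∈ liftCode u a b B :=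
  subset_span (Or.inl ⟨i, rfl⟩)

theorem liftCode_eq_liftCode_iff [Fintype ι] (hu : IsDualNumberRing F u) (ha : ∀ i, a i ∈ B)
    (hli : LinearIndependent F a) {b' : ι → Fin n → F} :
    liftCode u a b' B = liftCode u a b B ↔ ∀ i, b' i - b i ∈ B := by
  have hsub : ∀ i, pairVec u (0, b' i - b i) = pairVec u (a i, b' i) - pairVec u (a i, b i) := by
    intro i
    rw [← map_sub]
    simp
  constructor
  · intro h i
    rw [← hu.torsionCode_liftCode (b := b) ha hli, mem_torsionCode, hsub]
    exact sub_mem (h ▸ pairVec_mem_liftCode i) (pairVec_mem_liftCode i)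
  · intro h
    have h1 := hu.liftCode_torsionCode (C := liftCode u a b B) (a := a) (b := b')
      (hu.residueCode_liftCode ha).symm (fun i => by
        have h2 : pairVec u (0, b' i - b i) ∈ liftCode u a b B :=
          subset_span (Or.inr ⟨_, h i, rfl⟩)
        rw [hsub] at h2
        simpa using add_mem h2 (pairVec_mem_liftCode i))
    rwa [hu.torsionCode_liftCode ha hli] at h1

theorem isSelfOrthogonal_liftCode_iff [Fintype ι] (hu : IsDualNumberRing F u)
    (ha : ∀ i, a i ∈ B) (hB : ∀ i, ∀ β ∈ B, a i ⬝ᵥ β = 0) :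
    IsSelfOrthogonal (liftCode u a b B) ↔ ∀ i j, a i ⬝ᵥ b j + a j ⬝ᵥ b i = 0 := by
  rw [hu.isSelfOrthogonal_iff]
  constructor
  · intro h i j
    have := (h _ _ (pairVec_mem_liftCode i) (pairVec_mem_liftCode j)).2
    rwa [dotProduct_comm (b i)] at this
  · intro h p q hp hq
    obtain ⟨x, β, hβ, hx⟩ := (hu.mem_liftCode ha).1 hp
    obtain ⟨y, γ, hγ, hy⟩ := (hu.mem_liftCode ha).1 hq
    obtain rfl := hu.pairVec_injective hx
    obtain rfl := hu.pairVec_injective hy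
    have h1 : ∀ x : ι → F, ∀ β ∈ B, (∑ i, x i • a i) ⬝ᵥ β = 0 := by
      intro x β hβ
      rw [sum_dotProduct]
      exact Finset.sum_eq_zero fun i _ => by rw [smul_dotProduct, hB i β hβ, smul_zero]
    refine ⟨h1 _ _ (sum_mem fun i _ => smul_mem _ _ (ha i)), ?_⟩
    simp only [dotProduct_add, add_dotProduct, h1 x γ hγ, dotProduct_comm β, h1 y β hβ, add_zero]
    simp only [sum_dotProduct, dotProduct_sum, smul_dotProduct, dotProduct_smul, smul_eq_mul]
    rw [← Finset.sum_add_distrib]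
    refine Finset.sum_eq_zero fun j _ => ?_
    rw [← mul_add, ← Finset.sum_add_distrib, Finset.sum_eq_zero, mul_zero]
    intro i _
    rw [← mul_add, dotProduct_comm (b i), h, mul_zero]

end Lift

end IsDualNumberRing

end Codes

/-! ### Counting self-orthogonal codes -/

section Orthogonal

variable {F : Type*} [Field F] {n : ℕ}

theorem dotProductBilin_nondegenerate :
    LinearMap.BilinForm.Nondegenerate (dotProductBilin F F : LinearMap.BilinForm F (Fin n → F)) :=
  ⟨fun x hx => dotProduct_eq_zero _ hx,
    fun x hx => dotProduct_eq_zero _ fun y => by rw [dotProduct_comm]; exact hx y⟩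

theorem exists_dotProduct_eq {k : ℕ} {a : Fin k → Fin n → F} (ha : LinearIndependent F a)
    (t : Fin k → F) : ∃ y : Fin n → F, ∀ i, a i ⬝ᵥ y = t i := by
  have hr : (Matrix.of a).rank = k := by
    simpa using LinearIndependent.rank_matrix (M := Matrix.of a) ha
  have hs : LinearMap.range (Matrix.of a).mulVecLin = ⊤ := by
    refine eq_top_of_finrank_eq ?_
    rw [finrank_fin_fun]
    exact hr
  obtain ⟨y, hy⟩ := LinearMap.range_eq_top.1 hs t
  exact ⟨y, fun i => congrFun hy i⟩

/-- The entries above the diagonal of the symmetrization of the matrix `aᵢ ⬝ᵥ bⱼ`. -/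
def symmetrization {k : ℕ} (a : Fin k → Fin n → F) :
    (Fin k → Fin n → F) →ₗ[F] ((Σ j : Fin k, Fin j) → F) where
  toFun b p := a (p.2.castLE p.1.2.le) ⬝ᵥ b p.1 + a p.1 ⬝ᵥ b (p.2.castLE p.1.2.le)
  map_add' b c := by
    ext p
    simp only [Pi.add_apply, dotProduct_add]
    ring
  map_smul' s b := by
    ext p
    simp only [Pi.smul_apply, dotProduct_smul, smul_add, RingHom.id_apply]

theorem mem_ker_symmetrization [CharP F 2] {k : ℕ} {a b : Fin k → Fin n → F} :
    b ∈ LinearMap.ker (symmetrization a) ↔ ∀ i j, a i ⬝ᵥ b j + a j ⬝ᵥ b i = 0 := by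
  constructor
  · intro h i j
    have h' : ∀ i j : Fin k, i < j → a i ⬝ᵥ b j + a j ⬝ᵥ b i = 0 := fun i j hij =>
      congrFun (LinearMap.mem_ker.1 h) ⟨j, ⟨i, hij⟩⟩
    rcases lt_trichotomy i j with hij | rfl | hij
    · exact h' i j hij
    · exact CharTwo.add_self_eq_zero _
    · rw [add_comm]
      exact h' j i hij
  · intro h
    exact LinearMap.mem_ker.2 (funext fun p => h _ _)

/-- For independent `a` all products `aᵢ ⬝ᵥ bⱼ` can be prescribed, those below the diagonal as
zero. -/
theorem symmetrization_surjective {k : ℕ} {a : Fin k → Fin n → F} (ha : LinearIndependent F a) :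
    Function.Surjective (symmetrization a) := by
  intro t
  choose b hb using fun j : Fin k => exists_dotProduct_eq ha
    (fun i => if h : i < j then t ⟨j, ⟨i, h⟩⟩ else 0)
  refine ⟨b, funext fun p => ?_⟩
  obtain ⟨j, i⟩ := p
  change a (i.castLE j.2.le) ⬝ᵥ b j + a j ⬝ᵥ b (i.castLE j.2.le) = _
  have hij : i.castLE j.2.le < j := i.2
  rw [hb, hb, dif_pos hij, dif_neg hij.not_gt, add_zero]
  rfl

theorem card_symmetrization_eq_zero [Finite F] [CharP F 2] {k : ℕ} {a : Fin k → Fin n → F}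
    (ha : LinearIndependent F a) :
    Nat.card {b : Fin k → Fin n → F // ∀ i j, a i ⬝ᵥ b j + a j ⬝ᵥ b i = 0} *
      Nat.card F ^ (∑ i ∈ Finset.range k, i) = Nat.card F ^ (k * n) := by
  have h := LinearMap.finrank_range_add_finrank_ker (symmetrization a)
  rw [LinearMap.range_eq_top.2 (symmetrization_surjective ha), finrank_top] at h
  have h1 : finrank F ((Σ j : Fin k, Fin j) → F) = ∑ i ∈ Finset.range k, i := by
    rw [finrank_fintype_fun_eq_card, Fintype.card_sigma]
    simp only [Fintype.card_fin]
    exact Fin.sum_univ_eq_sum_range (fun i => i) k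
  have h2 : finrank F (Fin k → Fin n → F) = k * n := by
    rw [finrank_pi_fintype]
    simp
  rw [← Nat.card_congr (Equiv.subtypeEquivRight fun b => mem_ker_symmetrization (a := a) (b := b)),
    ← h2, ← h, h1, pow_add, mul_comm]
  congr 1
  exact natCard_eq_pow_finrank (K := F) (V := LinearMap.ker (symmetrization a))

end Orthogonal

section Count

variable {F R : Type*} [Field F] [CommRing R] [Algebra F R] {n : ℕ} {u : R}

namespace IsDualNumberRing

/-- The self-orthogonal codes with residue code `A` and torsion code `B` are given by the lifts
`aᵢ + u bᵢ` of a basis of `A`, where the `bᵢ` matter modulo `B` only and `aᵢ ⬝ᵥ bⱼ` is symmetric. -/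
theorem card_selfOrthogonal_code [Finite F] [CharP F 2] [Finite R] (hu : IsDualNumberRing F u)
    {A B : Submodule F (Fin n → F)} {k l : ℕ} (hA : finrank F A = k) (hB : finrank F B = l)
    (hAB : A ≤ B) (hperp : ∀ x ∈ A, ∀ y ∈ B, x ⬝ᵥ y = 0) :
    Nat.card {C : Submodule R (Fin n → R) //
        IsSelfOrthogonal C ∧ residueCode F u C = A ∧ torsionCode F u C = B} *
      Nat.card F ^ (k * l + ∑ i ∈ Finset.range k, i) = Nat.card F ^ (k * n) := by
  subst hA hB
  let e := finBasis F A
  set a : Fin (finrank F A) → Fin n → F := fun i => e i with ha_def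
  have hli : LinearIndependent F a := e.linearIndependent.map' A.subtype A.ker_subtype
  have hspan : span F (Set.range a) = A := by
    have : Set.range a = A.subtype '' Set.range e := by
      rw [← Set.range_comp]
      rfl
    rw [this, span_image, e.span_eq, map_subtype_top]
  have haB : ∀ i, a i ∈ B := fun i => hAB (e i).2
  have haperp : ∀ i, ∀ β ∈ B, a i ⬝ᵥ β = 0 := fun i β hβ => hperp _ (e i).2 β hβ
  rw [← card_symmetrization_eq_zero hli, pow_add, ← mul_assoc]
  congr 1
  symm
  refine card_eq_card_mul_of_card_fiber
    (fun b => ⟨liftCode u a b.1 B, (hu.isSelfOrthogonal_liftCode_iff haB haperp).2 b.2,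
      (hu.residueCode_liftCode haB).trans hspan, hu.torsionCode_liftCode haB hli⟩) _ ?_
  rintro ⟨C, hC, hCA, hCB⟩
  have hex : ∀ i, ∃ b, pairVec u (a i, b) ∈ C := fun i =>
    mem_residueCode.1 (hCA ▸ (e i).2 : a i ∈ residueCode F u C)
  choose b hb using hex
  have hCb : liftCode u a b B = C := by
    have := hu.liftCode_torsionCode (hspan.trans hCA.symm) hb
    rwa [hCB] at this
  have hcard : Nat.card (Fin (finrank F A) → B) = Nat.card F ^ (finrank F A * finrank F B) := by
    rw [Nat.card_fun, natCard_eq_pow_finrank (K := F) (V := B), ← pow_mul, mul_comm]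
    simp
  rw [← hcard]
  refine Nat.card_congr
    { toFun := fun c i => ⟨c.1.1 i - b i, ?_⟩
      invFun := fun d => ⟨⟨fun i => d i + b i, ?_⟩, Subtype.ext ?_⟩
      left_inv := fun c => by simp
      right_inv := fun d => by simp }
  · have hc : liftCode u a c.1.1 B = C := congrArg Subtype.val c.2
    exact (hu.liftCode_eq_liftCode_iff haB hli).1 (hc.trans hCb.symm) i
  · rw [← hu.isSelfOrthogonal_liftCode_iff haB haperp,
      (hu.liftCode_eq_liftCode_iff (b := b) haB hli).2 fun i => by simp, hCb]
    exact hC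
  · exact ((hu.liftCode_eq_liftCode_iff (b := b) haB hli).2 fun i => by simp).trans hCb

/-- Summing over the admissible pairs of a residue code and a torsion code. -/
theorem card_selfOrthogonal_finrank [Finite F] [CharP F 2] [Finite R]
    (hu : IsDualNumberRing F u) {m l₁ l₂ : ℕ} (hm : Nat.card F = 2 ^ m) (hn : 2 * l₁ + l₂ ≤ n) :
    (Nat.card {C : Submodule R (Fin n → R) // IsSelfOrthogonal C ∧
        finrank F (residueCode F u C) = l₁ ∧ finrank F (torsionCode F u C) = l₁ + l₂} : ℚ) =
      numS m n l₁ * ((2 : ℚ) ^ m) ^ (l₁ * (n - (l₁ + l₂)) - l₁ * (l₁ - 1) / 2) *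
        gaussBinom ((2 : ℚ) ^ m) (l₂ + n - (l₁ + l₂) - l₁) l₂ := by
  have hq : 1 < Nat.card F := Finite.one_lt_card
  set q := Nat.card F with hq_def
  let perp : Submodule F (Fin n → F) → Submodule F (Fin n → F) :=
    fun A => LinearMap.BilinForm.orthogonal (dotProductBilin F F) A
  have hperp : ∀ A, finrank F (perp A) = n - finrank F A := fun A => by
    have := LinearMap.BilinForm.finrank_orthogonal
      (dotProductBilin_nondegenerate (F := F) (n := n)) A
    rwa [finrank_fin_fun] at this
  -- the admissible residue codes, and the admissible pairs of a residue and a torsion code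
  let SA := {A : Submodule F (Fin n → F) // finrank F A = l₁ ∧ ∀ x ∈ A, ∀ y ∈ A, x ⬝ᵥ y = 0}
  let SB := fun A : Submodule F (Fin n → F) =>
    {B : Submodule F (Fin n → F) // finrank F B = l₁ + l₂ ∧ A ≤ B ∧ B ≤ perp A}
  let G := Nat.card {B : Submodule F (Fin (n - l₁ - l₁) → F) // finrank F B = l₂}
  have hG : (G : ℚ) = gaussBinom q (n - l₁ - l₁) l₂ := by
    refine cast_eq_gaussBinom hq (by omega) ?_
    have := card_submodule_finrank_eq (F := F) (V := Fin (n - l₁ - l₁) → F) l₂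
      (by rw [finrank_fin_fun]; omega)
    rwa [finrank_fin_fun] at this
  have hSB : ∀ A : SA, Nat.card (SB A.1) = G := by
    rintro ⟨A, hA, hAA⟩
    have h1 := card_submodule_between (E := A) (D := perp A) (fun x hx y hy => hAA y hy x hx) l₂
      (by rw [hperp]; omega)
    rw [hperp, hA, ← hA] at h1
    have h2 := cast_eq_gaussBinom hq (by omega) h1
    rw [hA, ← hG] at h2
    exact Nat.cast_injective h2
  have hpairs : Nat.card (Σ A : SA, SB A.1) = Nat.card SA * G := by
    cases nonempty_fintype SA
    rw [Nat.card_sigma]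
    simp [hSB]
  have hmain : Nat.card {C : Submodule R (Fin n → R) // IsSelfOrthogonal C ∧
        finrank F (residueCode F u C) = l₁ ∧ finrank F (torsionCode F u C) = l₁ + l₂} =
      Nat.card (Σ A : SA, SB A.1) * q ^ (l₁ * (n - (l₁ + l₂)) - l₁ * (l₁ - 1) / 2) := by
    refine card_eq_card_mul_of_card_fiber
      (fun C => ⟨⟨residueCode F u C.1, C.2.2.1, fun x hx y hy =>
          hu.residueCode_dotProduct_torsionCode C.2.1 hx (hu.residueCode_le_torsionCode _ hy)⟩,
        ⟨torsionCode F u C.1, C.2.2.2, hu.residueCode_le_torsionCode _,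
          fun y hy x hx => hu.residueCode_dotProduct_torsionCode C.2.1 hx hy⟩⟩) _ ?_
    rintro ⟨⟨A, hA, hAA⟩, ⟨B, hB, hAB, hBA⟩⟩
    have h1 := hu.card_selfOrthogonal_code (R := R) hA hB hAB (fun x hx y hy => hBA hy x hx)
    rw [Finset.sum_range_id] at h1
    -- `l₁ ≤ n - (l₁ + l₂)` keeps the exponent from truncating
    have h2 : l₁ * n = l₁ * (n - (l₁ + l₂)) - l₁ * (l₁ - 1) / 2 +
        (l₁ * (l₁ + l₂) + l₁ * (l₁ - 1) / 2) := by
      have h3 : l₁ * (l₁ - 1) / 2 ≤ l₁ * (n - (l₁ + l₂)) :=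
        (Nat.div_le_self _ _).trans (Nat.mul_le_mul_left _ (by omega))
      have h4 : l₁ * n = l₁ * (n - (l₁ + l₂)) + l₁ * (l₁ + l₂) := by
        rw [← mul_add]
        congr 1
        omega
      omega
    rw [← hq_def, h2, pow_add q (l₁ * (n - (l₁ + l₂)) - l₁ * (l₁ - 1) / 2)] at h1
    refine Eq.trans ?_ (Nat.eq_of_mul_eq_mul_right (pow_pos (zero_lt_one.trans hq) _) h1)
    refine Nat.card_congr
      { toFun := fun C => ⟨C.1.1, C.1.2.1, ?_, ?_⟩
        invFun := fun C => ⟨⟨C.1, C.2.1, by rw [C.2.2.1, hA], by rw [C.2.2.2, hB]⟩, ?_⟩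
        left_inv := fun _ => rfl
        right_inv := fun _ => rfl }
    · exact congrArg (fun p => p.1.1) C.2
    · exact congrArg (fun p : (Σ A : SA, SB A.1) => (p.2.1 : Submodule F (Fin n → F))) C.2
    · obtain ⟨C, hC, rfl, rfl⟩ := C
      rfl
  have hqm : (q : ℚ) = 2 ^ m := by rw [hm]; simp
  have hexp : l₂ + n - (l₁ + l₂) - l₁ = n - l₁ - l₁ := by omega
  rw [hmain, hpairs, hexp]
  push_cast
  rw [hG, hqm, card_selfOrthogonal hm (by omega)]
  ring

end IsDualNumberRing

end Count

/-! ### Codes of a given type -/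

section Pivots

variable {F : Type*} [Field F] {n : ℕ}

theorem linearIndependent_sumElim_of_pivots {ι κ : Type*} [Fintype ι] [Fintype κ]
    [DecidableEq ι] [DecidableEq κ] {a : ι → Fin n → F} {c : κ → Fin n → F} {J : ι → Fin n}
    {K : κ → Fin n} (ha : ∀ i j, a i (J j) = if i = j then 1 else 0) (hc : ∀ i j, c i (J j) = 0)
    (hc' : ∀ i j, c i (K j) = if i = j then 1 else 0) :
    LinearIndependent F (Sum.elim a c) := by
  rw [Fintype.linearIndependent_iff]
  intro g hg
  have h1 : ∀ j, g (Sum.inl j) = 0 := by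
    intro j
    have := congrFun hg (J j)
    simpa [Fintype.sum_sum_type, ha, hc] using this
  rintro (j | j)
  · exact h1 j
  · have := congrFun hg (K j)
    simpa [Fintype.sum_sum_type, h1, hc'] using this

/-- A subspace of `F ^ n` has a basis in reduced echelon form, up to the order of the
coordinates. -/
theorem exists_pivots (A : Submodule F (Fin n → F)) {k : ℕ} (hk : finrank F A = k) :
    ∃ (J : Fin k → Fin n) (a : Fin k → Fin n → F),
      (∀ i j, a i (J j) = if i = j then 1 else 0) ∧ span F (Set.range a) = A := by
  classical
  obtain ⟨κ, c, hc, hspan, hli⟩ := exists_linearIndependent' F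
    (fun i : Fin n => (LinearMap.proj i ∘ₗ A.subtype : Dual F A))
  have : Finite κ := Finite.of_injective c hc
  cases nonempty_fintype κ
  let ρ : A →ₗ[F] (κ → F) := LinearMap.pi fun j => LinearMap.proj (c j) ∘ₗ A.subtype
  have hρ : Function.Injective ρ := by
    refine (injective_iff_map_eq_zero _).2 fun x hx => Subtype.ext (funext fun i => ?_)
    -- every coordinate functional on `A` is a combination of the selected ones
    have hi : (LinearMap.proj i ∘ₗ A.subtype : Dual F A) ∈
        LinearMap.ker (Dual.eval F A x) := by
      refine span_le.2 ?_ (hspan ▸ subset_span (Set.mem_range_self i))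
      rintro _ ⟨j, rfl⟩
      exact congrFun hx j
    exact hi
  have hcard : Fintype.card κ = k := by
    refine le_antisymm ?_ ?_
    · rw [← hk, ← Subspace.dual_finrank_eq]
      exact hli.fintype_card_le_finrank
    · have := LinearMap.finrank_le_finrank_of_injective hρ
      rwa [hk, finrank_fintype_fun_eq_card] at this
  have hsurj : Function.Surjective ρ :=
    (LinearMap.injective_iff_surjective_of_finrank_eq_finrank
      (by rw [hk, finrank_fintype_fun_eq_card, hcard])).1 hρ
  let e : Fin k ≃ κ := (Fintype.equivFinOfCardEq hcard).symm
  choose a ha using fun i : Fin k => hsurj (Pi.single (e i) 1)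
  have hdelta : ∀ i j, (a i : Fin n → F) (c (e j)) = if i = j then 1 else 0 := by
    intro i j
    have := congrFun (ha i) (e j)
    rw [Pi.single_apply] at this
    change (a i : Fin n → F) (c (e j)) = _ at this
    simpa [eq_comm] using this
  refine ⟨fun j => c (e j), fun i => a i, hdelta, eq_of_le_of_finrank_eq (span_le.2 ?_) ?_⟩
  · rintro _ ⟨i, rfl⟩
    exact (a i).2
  · have hli : LinearIndependent F (fun i => (a i : Fin n → F)) :=
      (linearIndependent_sumElim_of_pivots (c := fun i : Empty => i.elim) (K := fun i => i.elim)
        hdelta (fun i => i.elim) (fun i => i.elim)).comp Sum.inl Sum.inl_injective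
    rw [finrank_span_eq_card hli, hk, Fintype.card_fin]

/-- Pivots of a subspace extend to pivots of a larger subspace: the new ones are pivots of the
subspace of vectors that vanish at the old ones. -/
theorem exists_pivots_of_le {A B : Submodule F (Fin n → F)} (hAB : A ≤ B) {k l : ℕ}
    (hA : finrank F A = k) (hB : finrank F B = k + l) :
    ∃ (J : Fin k → Fin n) (K : Fin l → Fin n) (a : Fin k → Fin n → F) (c : Fin l → Fin n → F),
      (∀ i j, a i (J j) = if i = j then 1 else 0) ∧ (∀ i j, c i (J j) = 0) ∧
      (∀ i j, c i (K j) = if i = j then 1 else 0) ∧ span F (Set.range a) = A ∧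
      span F (Set.range (Sum.elim a c)) = B := by
  obtain ⟨J, a, ha, haA⟩ := exists_pivots A hA
  let B₀ : Submodule F (Fin n → F) := B ⊓ LinearMap.ker (LinearMap.funLeft F F J)
  have hB₀ : ∀ x ∈ B₀, ∀ j, x (J j) = 0 := fun x hx j => congrFun (LinearMap.mem_ker.1 hx.2) j
  have haB : ∀ i, a i ∈ B := fun i => hAB (haA ▸ subset_span ⟨i, rfl⟩)
  have hinf : A ⊓ B₀ = ⊥ := by
    refine _root_.eq_bot_iff.2 fun x hx => ?_
    obtain ⟨g, rfl⟩ := (mem_span_range_iff_exists_fun F).1 (haA.symm ▸ hx.1 :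
      x ∈ span F (Set.range a))
    have hg : ∀ j, g j = 0 := fun j => by simpa [ha] using hB₀ _ hx.2 j
    simp [hg]
  have hsup : A ⊔ B₀ = B := by
    refine le_antisymm (sup_le hAB inf_le_left) fun x hx => ?_
    have hs : ∑ i, x (J i) • a i ∈ A := haA ▸ sum_mem fun i _ =>
      smul_mem _ _ (subset_span ⟨i, rfl⟩)
    refine mem_sup.2 ⟨_, hs, x - ∑ i, x (J i) • a i, ⟨sub_mem hx (hAB hs), ?_⟩, by simp⟩
    refine LinearMap.mem_ker.2 (funext fun j => ?_)
    simp [LinearMap.funLeft_apply, ha]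
  have hfin := finrank_sup_add_finrank_inf_eq A B₀
  rw [hinf, hsup, finrank_bot] at hfin
  obtain ⟨K, c, hc, hcB⟩ := exists_pivots B₀ (k := l) (by omega)
  refine ⟨J, K, a, c, ha, fun i j => hB₀ _ (hcB ▸ subset_span ⟨i, rfl⟩) j, hc, haA, ?_⟩
  rw [Set.Sum.elim_range, span_union, haA, hcB, hsup]

theorem exists_sub_vanishing_at_pivots {ι κ : Type*} [Fintype ι] [Fintype κ] [DecidableEq ι]
    [DecidableEq κ] {a : ι → Fin n → F} {c : κ → Fin n → F} {J : ι → Fin n} {K : κ → Fin n}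
    (ha : ∀ i j, a i (J j) = if i = j then 1 else 0) (hc : ∀ i j, c i (J j) = 0)
    (hc' : ∀ i j, c i (K j) = if i = j then 1 else 0) (v : Fin n → F) :
    ∃ β ∈ span F (Set.range (Sum.elim a c)),
      (∀ j, (v - β) (J j) = 0) ∧ ∀ j, (v - β) (K j) = 0 := by
  let w := v - ∑ i, v (J i) • a i
  refine ⟨∑ i, v (J i) • a i + ∑ i, w (K i) • c i, add_mem
    (sum_mem fun i _ => smul_mem _ _ (subset_span ⟨Sum.inl i, rfl⟩))
    (sum_mem fun i _ => smul_mem _ _ (subset_span ⟨Sum.inr i, rfl⟩)), ?_, ?_⟩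
  · intro j
    simp [ha, hc]
  · intro j
    rw [← sub_sub]
    change (w - _) (K j) = 0
    simp [hc']

theorem exists_equiv_extending {k l : ℕ} {f : Fin k ⊕ Fin l → Fin n} (hf : Function.Injective f) :
    ∃ τ : (Fin k ⊕ Fin l) ⊕ Fin (n - (k + l)) ≃ Fin n, ∀ x, τ (Sum.inl x) = f x := by
  classical
  have hcard : Fintype.card {x // x ∉ Set.range f} = n - (k + l) := by
    rw [Fintype.card_subtype_compl]
    change Fintype.card (Fin n) - Fintype.card (Set.range f) = _
    rw [Set.card_range_of_injective hf]
    simp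
  refine ⟨((Equiv.ofInjective f hf).sumCongr (Fintype.equivFinOfCardEq hcard).symm).trans
    (Equiv.Set.sumCompl (Set.range f)), fun x => ?_⟩
  exact Equiv.Set.sumCompl_apply_inl _ _

end Pivots

section HasType

variable {F R : Type*} [Field F] [CommRing R] [Algebra F R] {n : ℕ} {u : R}

namespace IsDualNumberRing

/-- The rows `aᵢ + u bᵢ` and `u cᵢ` generate a code whose torsion code is spanned by the `aᵢ` and
the `cᵢ`. -/
theorem span_rows_eq_liftCode (hu : IsDualNumberRing F u) {ι κ : Type*}
    (a b : ι → Fin n → F) (c : κ → Fin n → F) :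
    span R (Set.range (Sum.elim (fun i => pairVec u (a i, b i)) fun i => pairVec u (0, c i))) =
      liftCode u a b (span F (Set.range (Sum.elim a c))) := by
  refine le_antisymm (span_le.2 ?_) (span_le.2 (Set.union_subset ?_ ?_))
  · rintro _ ⟨i | i, rfl⟩
    · exact pairVec_mem_liftCode i
    · exact subset_span (Or.inr ⟨c i, subset_span ⟨Sum.inr i, rfl⟩, rfl⟩)
  · rintro _ ⟨i, rfl⟩
    exact subset_span ⟨Sum.inl i, rfl⟩
  · set C := span R (Set.range (Sum.elim (fun i => pairVec u (a i, b i))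
      fun i => pairVec u (0, c i))) with hC
    have h : span F (Set.range (Sum.elim a c)) ≤ torsionCode F u C := by
      refine span_le.2 ?_
      rintro _ ⟨i | i, rfl⟩
      · exact hu.residueCode_le_torsionCode C
          (mem_residueCode.2 ⟨b i, subset_span ⟨Sum.inl i, rfl⟩⟩)
      · exact mem_torsionCode.2 (subset_span ⟨Sum.inr i, rfl⟩)
    rintro _ ⟨β, hβ, rfl⟩
    exact h hβ

theorem eq_of_algebraMap_eq (hu : IsDualNumberRing F u) {a b a' b' : F}
    (h : algebraMap F R a + u * algebraMap F R b = algebraMap F R a' + u * algebraMap F R b') :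
    a = a' ∧ b = b' := by
  have := hu.eq_zero (a - a') (b - b') (by
    rw [map_sub, map_sub]
    linear_combination h)
  exact ⟨sub_eq_zero.1 this.1, sub_eq_zero.1 this.2⟩

/-- The identity blocks of the standard form provide pivots, so that the rows are independent over the
residue field. -/
theorem finrank_of_hasType (hu : IsDualNumberRing F u) {m l₁ l₂ : ℕ}
    {C : Submodule R (Fin n → R)} (hC : HasType u m C l₁ l₂) :
    finrank F (residueCode F u C) = l₁ ∧ finrank F (torsionCode F u C) = l₁ + l₂ := by
  obtain ⟨τ, A₁₁, A₁₂, A₂₂, -, -, rfl⟩ := hC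
  choose a b hab using fun i : Fin l₁ => hu.exists_pairVec_eq
    (fun k => standardMatrix u A₁₁ A₁₂ A₂₂ (Sum.inl i) (τ.symm k))
  choose c d hcd using fun i : Fin l₂ => hu.exists_pairVec_eq
    (fun k => Sum.elim (Sum.elim (fun _ => 0) fun j => if i = j then 1 else 0) (A₂₂ i) (τ.symm k))
  have hrow : ∀ i : Fin l₂,
      (fun k => standardMatrix u A₁₁ A₁₂ A₂₂ (Sum.inr i) (τ.symm k)) = pairVec u (0, c i) := by
    intro i
    rw [← hu.u_smul_pairVec (c i) (d i), ← hcd]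
    ext k
    rcases h : τ.symm k with (j | j) | j <;>
      simp [standardMatrix, h, Matrix.one_apply]
  have ha : ∀ i j, a i (τ (Sum.inl (Sum.inl j))) = if i = j then 1 else 0 := by
    intro i j
    have h := congrFun (hab i) (τ (Sum.inl (Sum.inl j)))
    rw [pairVec_apply] at h
    refine (hu.eq_of_algebraMap_eq (b' := 0) (h.symm.trans ?_)).1
    split_ifs with hij <;> simp [standardMatrix, hij]
  have hc : ∀ i j, c i (τ (Sum.inl (Sum.inl j))) = 0 := by
    intro i j
    have h := congrFun (hcd i) (τ (Sum.inl (Sum.inl j)))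
    rw [pairVec_apply] at h
    refine (hu.eq_of_algebraMap_eq (b' := 0) (h.symm.trans ?_)).1
    simp
  have hc' : ∀ i j, c i (τ (Sum.inl (Sum.inr j))) = if i = j then 1 else 0 := by
    intro i j
    have h := congrFun (hcd i) (τ (Sum.inl (Sum.inr j)))
    rw [pairVec_apply] at h
    refine (hu.eq_of_algebraMap_eq (b' := 0) (h.symm.trans ?_)).1
    split_ifs with hij <;> simp [hij]
  have hli := linearIndependent_sumElim_of_pivots ha hc hc'
  have hli' : LinearIndependent F a := hli.comp Sum.inl Sum.inl_injective
  have hmem : ∀ i, a i ∈ span F (Set.range (Sum.elim a c)) := fun i =>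
    subset_span ⟨Sum.inl i, rfl⟩
  have hspan : (fun r => fun k : Fin n => standardMatrix u A₁₁ A₁₂ A₂₂ r (τ.symm k)) =
      Sum.elim (fun i => pairVec u (a i, b i)) fun i => pairVec u (0, c i) := by
    funext r
    rcases r with i | i
    · exact hab i
    · exact hrow i
  rw [hspan, hu.span_rows_eq_liftCode, hu.residueCode_liftCode hmem,
    hu.torsionCode_liftCode hmem hli', finrank_span_eq_card hli', finrank_span_eq_card hli]
  simp

/-- With pivots `J` of the residue code `A`, extended by `K` to the torsion code `B`, the lifts of the
basis of `A` can be changed by elements of `u B` so that their `u`-parts vanish at `J` and `K`. Then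
the block at `K` has Teichmüller entries. -/
theorem hasType_of_finrank (hu : IsDualNumberRing F u) {m l₁ l₂ : ℕ}
    (hT : ∀ x : F, algebraMap F R x ∈ teichmullerSet R m) {C : Submodule R (Fin n → R)}
    (h₁ : finrank F (residueCode F u C) = l₁) (h₂ : finrank F (torsionCode F u C) = l₁ + l₂) :
    HasType u m C l₁ l₂ := by
  obtain ⟨J, K, a, c, ha, hc, hc', haA, hacB⟩ :=
    exists_pivots_of_le (hu.residueCode_le_torsionCode C) h₁ h₂
  have hinj : Function.Injective (Sum.elim J K) := by
    rintro (i | i) (j | j) hij <;> simp only [Sum.elim_inl, Sum.elim_inr] at hij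
    · have h := ha i i
      rw [hij, ha] at h
      simpa using h
    · have h := hc j i
      rw [hij, hc'] at h
      simp at h
    · have h := hc i j
      rw [← hij, hc'] at h
      simp at h
    · have h := hc' i i
      rw [hij, hc'] at h
      simpa using h
  obtain ⟨τ, hτ⟩ := exists_equiv_extending hinj
  have hJ : ∀ j, τ (Sum.inl (Sum.inl j)) = J j := fun j => hτ _
  have hK : ∀ j, τ (Sum.inl (Sum.inr j)) = K j := fun j => hτ _
  have hlift : ∀ i, ∃ b : Fin n → F, pairVec u (a i, b) ∈ C ∧ (∀ j, b (J j) = 0) ∧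
      ∀ j, b (K j) = 0 := by
    intro i
    obtain ⟨b, hb⟩ := mem_residueCode.1 (haA ▸ subset_span ⟨i, rfl⟩ : a i ∈ residueCode F u C)
    obtain ⟨β, hβ, hβJ, hβK⟩ := exists_sub_vanishing_at_pivots ha hc hc' b
    refine ⟨b - β, ?_, hβJ, hβK⟩
    have h : pairVec u (a i, b - β) = pairVec u (a i, b) - pairVec u (0, β) := by
      rw [← map_sub]
      simp
    rw [h]
    rw [hacB] at hβ
    exact sub_mem hb hβ
  choose b hb hbJ hbK using hlift
  refine ⟨τ, Matrix.of fun i j => algebraMap F R (a i (K j)),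
    Matrix.of fun i j => pairVec u (a i, b i) (τ (Sum.inr j)),
    Matrix.of fun i j => algebraMap F R (c i (τ (Sum.inr j))), fun _ _ => hT _, fun _ _ => hT _, ?_⟩
  have hC := hu.liftCode_torsionCode haA hb
  rw [← hacB, ← hu.span_rows_eq_liftCode] at hC
  rw [← hC]
  congr 2
  funext r k
  obtain ⟨x, rfl⟩ := τ.surjective k
  rw [Equiv.symm_apply_apply]
  rcases r with i | i <;> rcases x with (j | j) | j
  · simp [pairVec_apply, standardMatrix, Matrix.one_apply, hJ, ha, hbJ]
  · simp [pairVec_apply, standardMatrix, hK, hbK]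
  · simp [standardMatrix]
  · simp [pairVec_apply, standardMatrix, hJ, hc]
  · simp [pairVec_apply, standardMatrix, hK, hc', Matrix.one_apply]
  · simp [pairVec_apply, standardMatrix]

end IsDualNumberRing

end HasType

/-! ### The chain ring as a ring of dual numbers -/

section ChainRing

variable {R : Type*} [CommRing R] {u : R} {m : ℕ}

namespace IsEvenChainRing

theorem finite_residue (hR : IsEvenChainRing R u 2 2 m) : Finite (R ⧸ Ideal.span {u}) :=
  have := hR.finite
  Finite.of_surjective _ Ideal.Quotient.mk_surjective

theorem charP_two (hR : IsEvenChainRing R u 2 2 m) : CharP R 2 := by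
  refine CharTwo.of_one_ne_zero_of_two_eq_zero ?_ ?_
  · simpa using hR.pow_ne_zero 0 (by norm_num)
  · have h := hR.two_mem
    rwa [hR.pow_eq_zero, Ideal.span_singleton_zero, Ideal.mem_bot] at h

theorem two_le_two_pow (hR : IsEvenChainRing R u 2 2 m) : 2 ≤ 2 ^ m := by
  have := hR.finite_residue
  have : Nontrivial (R ⧸ Ideal.span {u}) :=
    Ideal.Quotient.nontrivial_iff.2 hR.isMaximal.ne_top
  rw [← hR.card_residue]
  exact Finite.one_lt_card

/-- The Teichmüller lift: `x ↦ x ^ (2 ^ m)` is an iterate of the Frobenius endomorphism, as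
`R` has characteristic two, and it annihilates `⟨u⟩`. -/
noncomputable def teichmullerLift (hR : IsEvenChainRing R u 2 2 m) :
    R ⧸ Ideal.span {u} →+* R :=
  haveI := hR.charP_two
  Ideal.Quotient.lift (Ideal.span {u}) (iterateFrobenius R 2 m) fun x hx => by
    obtain ⟨y, rfl⟩ := Ideal.mem_span_singleton'.1 hx
    rw [iterateFrobenius_def, mul_pow, pow_eq_zero_of_le hR.two_le_two_pow hR.pow_eq_zero,
      mul_zero]

theorem teichmullerLift_mk (hR : IsEvenChainRing R u 2 2 m) (x : R) :
    hR.teichmullerLift (Ideal.Quotient.mk _ x) = x ^ 2 ^ m := rfl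

theorem residue_pow_card (hR : IsEvenChainRing R u 2 2 m) (a : R ⧸ Ideal.span {u}) :
    a ^ 2 ^ m = a := by
  have := hR.finite_residue
  have := hR.isMaximal
  let _ := Ideal.Quotient.field (Ideal.span {u})
  cases nonempty_fintype (R ⧸ Ideal.span {u})
  rw [← hR.card_residue, Nat.card_eq_fintype_card]
  exact FiniteField.pow_card a

theorem mk_teichmullerLift (hR : IsEvenChainRing R u 2 2 m) (a : R ⧸ Ideal.span {u}) :
    Ideal.Quotient.mk _ (hR.teichmullerLift a) = a := by
  obtain ⟨x, rfl⟩ := Ideal.Quotient.mk_surjective a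
  rw [teichmullerLift_mk, map_pow, hR.residue_pow_card]

theorem exists_eq_lift_add (hR : IsEvenChainRing R u 2 2 m) (x : R) :
    ∃ y, x = hR.teichmullerLift (Ideal.Quotient.mk _ x) + u * y := by
  have h : x - hR.teichmullerLift (Ideal.Quotient.mk _ x) ∈ Ideal.span {u} := by
    rw [← Ideal.Quotient.eq_zero_iff_mem, map_sub, hR.mk_teichmullerLift, sub_self]
  obtain ⟨y, hy⟩ := Ideal.mem_span_singleton'.1 h
  exact ⟨y, by linear_combination -hy⟩

theorem teichmullerLift_mem (hR : IsEvenChainRing R u 2 2 m) (a : R ⧸ Ideal.span {u}) :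
    hR.teichmullerLift a ∈ teichmullerSet R m := by
  have := hR.isMaximal
  let _ := Ideal.Quotient.field (Ideal.span {u})
  rcases eq_or_ne a 0 with rfl | ha
  · exact Or.inl (map_zero _)
  · right
    rw [← map_pow]
    have h : a ^ (2 ^ m - 1) = 1 := by
      refine mul_left_cancel₀ ha ?_
      rw [mul_one, ← pow_succ', Nat.sub_add_cancel Nat.one_le_two_pow, hR.residue_pow_card]
    rw [h, map_one]

/-- The residue field acts on `R` through the Teichmüller lift. -/
theorem isDualNumberRing (hR : IsEvenChainRing R u 2 2 m) :
    haveI := hR.isMaximal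
    letI := Ideal.Quotient.field (Ideal.span {u})
    letI := hR.teichmullerLift.toAlgebra
    IsDualNumberRing (R ⧸ Ideal.span {u}) u := by
  have := hR.isMaximal
  let _ := Ideal.Quotient.field (Ideal.span {u})
  let _ := hR.teichmullerLift.toAlgebra
  have hu : u * u = 0 := by rw [← sq, hR.pow_eq_zero]
  refine ⟨hu, fun x => ?_, fun a b h => ?_⟩
  · obtain ⟨y, hy⟩ := hR.exists_eq_lift_add x
    obtain ⟨z, hz⟩ := hR.exists_eq_lift_add y
    refine ⟨Ideal.Quotient.mk _ x, Ideal.Quotient.mk _ y, ?_⟩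
    change x = hR.teichmullerLift _ + u * hR.teichmullerLift _
    linear_combination hy + u * hz + z * hu
  · change hR.teichmullerLift a + u * hR.teichmullerLift b = 0 at h
    have ha : a = 0 := by
      have h' := congrArg (Ideal.Quotient.mk (Ideal.span {u})) h
      rw [map_add, map_mul, hR.mk_teichmullerLift,
        Ideal.Quotient.eq_zero_iff_mem.2 (Ideal.mem_span_singleton_self u), zero_mul, add_zero,
        map_zero] at h'
      exact h'
    refine ⟨ha, by_contra fun hb => ?_⟩
    rw [ha, map_zero, zero_add] at h
    have hunit : IsUnit (hR.teichmullerLift b) := (IsUnit.mk0 b hb).map hR.teichmullerLift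
    refine hR.pow_ne_zero 1 (by norm_num) ?_
    rw [pow_one]
    exact hunit.mul_left_eq_zero.1 h

end IsEvenChainRing

end ChainRing

theorem theorem4p1 {R : Type*} [CommRing R] (u : R) (m : ℕ) (hR : IsEvenChainRing R u 2 2 m)
    (n l₁ l₂ : ℕ) (hn : 2 * l₁ + l₂ ≤ n) :
    (numSelfOrthogonal u m n l₁ l₂ : ℚ) =
      numS m n l₁ * ((2 : ℚ) ^ m) ^ (l₁ * (n - (l₁ + l₂)) - l₁ * (l₁ - 1) / 2) *
        gaussBinom ((2 : ℚ) ^ m) (l₂ + n - (l₁ + l₂) - l₁) l₂ := by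
  have := hR.finite
  have := hR.finite_residue
  have := hR.isMaximal
  let _ := Ideal.Quotient.field (Ideal.span {u})
  let _ := hR.teichmullerLift.toAlgebra
  have hu : IsDualNumberRing (R ⧸ Ideal.span {u}) u := hR.isDualNumberRing
  have hchar : CharP (R ⧸ Ideal.span {u}) 2 := by
    have := hR.charP_two
    refine CharTwo.of_one_ne_zero_of_two_eq_zero one_ne_zero ?_
    rw [← map_ofNat (Ideal.Quotient.mk (Ideal.span {u})) 2, CharTwo.two_eq_zero, map_zero]
  rw [← hu.card_selfOrthogonal_finrank hR.card_residue hn, numSelfOrthogonal]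
  congr 1
  refine Nat.card_congr (Equiv.subtypeEquivRight fun C => and_congr_right fun _ => ?_)
  exact ⟨hu.finrank_of_hasType, fun h => hu.hasType_of_finrank hR.teichmullerLift_mem h.1 h.2⟩
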